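/- **Consistency of the reweighted Nadaraya–Watson (RNW) estimator.** Let $w\ge 1$ and let $V_i=(\tilde X_i,\tilde Y_i)$, $i\ge 1$, be a strictly stationary process with values in $\mathbb R^w\times\mathbb R$ that is strongly mixing with $\alpha(\tau)=O(\tau^{-(2+\delta)})$ for some $\delta>0$, where $$\alpha(\tau)=\sup_{k\ge1}\ \sup_{A\in\sigma(V_1,\dots,V_k),\ B\in\sigma(V_{k+\tau},V_{k+\tau+1},\dots)}|\mathbb P(A\cap B)-\mathbb P(A)\mathbb P(B)| .$$ Let $F(b\mid u)=\mathbb P(\tilde Y_1\le b\mid \tilde X_1=u)$ (a version obtained from a regular conditional distribution), let $g$ be a density of $\tilde X_1$ and, for $i\ge2$, let $g_{1,i}$ be a joint density of $(\tilde X_1,\tilde X_i)$. Fix $\tilde x\in\mathbb R^w$ and $\tilde y\in\mathbb R$ and assume: * $0<F(\tilde y\mid\tilde x)<1$, and $u\mapsto F(\tilde y\mid u)$ is twice continuously differentiable in a neighbourhood of $\tilde x$; * $g(\tilde x)>0$ and $g$ is continuous at $\tilde x$; there is $M>0$ with $|g_{1,i}(u,v)-g(u)g(v)|\le M$ for all $u,v$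 and all $i\ge2$; * $K:\mathbb R^w\to\mathbb R$ is a nonnegative, bounded, continuous, compactly supported probability density with $\int uK(u)\,du=0$, $\int uu^\top K(u)\,du=\mu_2 I$, $\int K^2(u)\,du=\nu_0$ and $\int uu^\top K^2(u)\,du=\nu_2I$ for some $\mu_2,\nu_0,\nu_2\in(0,\infty)$; * the bandwidths $h=h_n>0$ satisfy $h\to0$ and $nh^{w(1+2/\delta)}\to\infty$ as $n\to\infty$. Put $K_h(u)=h^{-w}K(u/h)$. Let the adjustment weights $p_1,\dots,p_n$ (depending on $\tilde x$ and the sample) maximize $\sum_{i=1}^n\log p_i$ subject to $p_i\ge0$, $\sum_{i=1}^np_i=1$ and $\sum_{i=1}^n p_i(\tilde X_i-\tilde x)K_h(\tilde X_i-\tilde x)=0\in\mathbb R^w$ (they may be chosen arbitrarily where this problem has no solution), and let $$\widehat F(\tilde y\mid\tilde x)=\frac{\sum_{i=1}^np_iK_h(\tilde X_i-\tilde x)\,\mathbb 1(\tilde Y_i\le\tilde y)}{\sum_{i=1}^np_iK_h(\tilde X_i-\tilde x)} .$$ Then, as $n\to\infty$, $$\widehat F(\tilde y\mid\tilde x)-F(\tilde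 y\mid\tilde x)=\tfrac12h^2\,\mathrm{tr}\big(D^2_{\tilde x}F(\tilde y\mid\tilde x)\big)\,\mu_2+o_p(h^2)+O_p\big((nh^w)^{-1/2}\big),$$ where $D^2_{\tilde x}F(\tilde y\mid\tilde x)$ is the Hessian of $u\mapsto F(\tilde y\mid u)$ at $u=\tilde x$. -/

import Mathlib

open MeasureTheory ProbabilityTheory Filter Topology

namespace RNW

/-- Predictors live in `ℝ^w` with the Euclidean norm and Lebesgue measure. -/
abbrev E (w : ℕ) : Type := EuclideanSpace ℝ (Fin w)

noncomputable section

/-! ### Dependence of the process -/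

section Dependence

variable {Ω S : Type*} [MeasurableSpace Ω] [MeasurableSpace S]

/-- The σ-algebra generated by `V_0, …, V_k`. -/
abbrev past (V : ℕ → Ω → S) (k : ℕ) : MeasurableSpace Ω :=
  ⨆ (i : ℕ) (_ : i ≤ k), MeasurableSpace.comap (V i) inferInstance

/-- The σ-algebra generated by `V_k, V_{k+1}, …`. -/
abbrev future (V : ℕ → Ω → S) (k : ℕ) : MeasurableSpace Ω :=
  ⨆ (i : ℕ) (_ : k ≤ i), MeasurableSpace.comap (V i) inferInstance

/-- The α-mixing coefficient of a one-sided process: the supremum of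
`|P(A ∩ B) - P(A) P(B)|` over all times `k`, all events `A` of the past up to `k` and all
events `B` of the future from `k + τ` on. For a stationary process it is the coefficient of the
two-sided stationary extension, where the single time `k = 0` is enough. -/
def alphaMixing (μ : Measure Ω) (V : ℕ → Ω → S) (τ : ℕ) : ℝ :=
  sSup {r : ℝ | ∃ (k : ℕ) (A B : Set Ω), MeasurableSet[past V k] A ∧
    MeasurableSet[future V (k + τ)] B ∧ r = |μ.real (A ∩ B) - μ.real A * μ.real B|}

/-- Strict stationarity: every time shift of the process has the same law as the process. -/
def IsStationary (μ : Measure Ω) (V : ℕ → Ω → S) : Prop :=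
  ∀ k : ℕ, μ.map (fun ω (i : ℕ) => V (i + k) ω) = μ.map (fun ω (i : ℕ) => V i ω)

/-- A strictly stationary, strongly mixing process with `α(τ) = O(τ^{-(2+δ)})`. -/
structure MixingAssumption (μ : Measure Ω) (V : ℕ → Ω → S) (δ : ℝ) : Prop where
  stationary : IsStationary μ V
  strongly_mixing : Tendsto (alphaMixing μ V) atTop (𝓝 0)
  rate : alphaMixing μ V =O[atTop] fun τ : ℕ => (τ : ℝ) ^ (-(2 + δ))

end Dependence

/-! ### Conditional distribution function, densities and their smoothness -/

/-- `f` is (a version of) the Lebesgue density of the random element `Z`. -/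
def HasDensity {Ω S : Type*} [MeasurableSpace Ω] [MeasureSpace S]
    (μ : Measure Ω) (Z : Ω → S) (f : S → ℝ) : Prop :=
  Measurable f ∧ (∀ z, 0 ≤ f z) ∧ μ.map Z = volume.withDensity (fun z => ENNReal.ofReal (f z))

/-- The conditional distribution function `F(b | x)` read off a conditional distribution `κ`. -/
def condCDF {w : ℕ} (κ : Kernel (E w) ℝ) (b : ℝ) (x : E w) : ℝ := (κ x).real (Set.Iic b)

/-- The Hessian matrix `(∂_j ∂_k f(x))_{j,k}`. -/
def hessian {w : ℕ} (f : E w → ℝ) (x : E w) : Matrix (Fin w) (Fin w) ℝ :=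
  Matrix.of fun j k => fderiv ℝ (fun z => fderiv ℝ f z (EuclideanSpace.single k 1)) x
    (EuclideanSpace.single j 1)

/-- Smoothness at the fixed points `x`, `y`: here `κ` gives the conditional distribution
function, `g` is the marginal density of the predictors and `G i` is the joint density of
the predictors at times `0` and `i`, for `i ≥ 1`. -/
structure SmoothnessAssumption {w : ℕ} (κ : Kernel (E w) ℝ) (g : E w → ℝ)
    (G : ℕ → E w × E w → ℝ) (x : E w) (y : ℝ) : Prop where
  cdf_pos : 0 < condCDF κ y x
  cdf_lt_one : condCDF κ y x < 1
  cdf_smooth : ContDiffAt ℝ 2 (fun z => condCDF κ y z) x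
  density_pos : 0 < g x
  density_cont : ContinuousAt g x
  joint_bound : ∃ M : ℝ, 0 < M ∧ ∀ i : ℕ, 1 ≤ i → ∀ u v : E w, |G i (u, v) - g u * g v| ≤ M

/-! ### Kernel function and bandwidth -/

/-- A nonnegative, bounded, continuous, compactly supported probability density with the
moment conditions `∫ u K = 0`, `∫ u uᵀ K = μ₂ I`, `∫ K² = ν₀`, `∫ u uᵀ K² = ν₂ I`. -/
structure KernelAssumption {w : ℕ} (K : E w → ℝ) (μ₂ ν₀ ν₂ : ℝ) : Prop where
  nonneg : ∀ u, 0 ≤ K u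
  bounded : ∃ C : ℝ, ∀ u, K u ≤ C
  continuous : Continuous K
  compact_support : HasCompactSupport K
  integral_one : ∫ u, K u = 1
  first_moment : ∫ u, K u • u = 0
  second_moment_pos : 0 < μ₂
  second_moment : ∀ j k : Fin w,
    ∫ u : E w, u j * u k * K u = (μ₂ • (1 : Matrix (Fin w) (Fin w) ℝ)) j k
  sq_pos : 0 < ν₀
  sq_integral : ∫ u, K u ^ 2 = ν₀
  sq_second_moment_pos : 0 < ν₂
  sq_second_moment : ∀ j k : Fin w,
    ∫ u : E w, u j * u k * K u ^ 2 = (ν₂ • (1 : Matrix (Fin w) (Fin w) ℝ)) j k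

/-- The rescaled kernel `K_h(u) = h^{-w} K(u / h)`. -/
def scaledKernel {w : ℕ} (K : E w → ℝ) (h : ℝ) (u : E w) : ℝ := (h ^ w)⁻¹ * K (h⁻¹ • u)

/-- Positive bandwidths with `h → 0` and `n h^{w (1 + 2/δ)} → ∞`. -/
structure BandwidthAssumption (w : ℕ) (δ : ℝ) (h : ℕ → ℝ) : Prop where
  pos : ∀ n, 0 < h n
  tendsto_zero : Tendsto h atTop (𝓝 0)
  tendsto_top : Tendsto (fun n : ℕ => (n : ℝ) * h n ^ ((w : ℝ) * (1 + 2 / δ))) atTop atTop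

/-! ### The reweighted Nadaraya-Watson estimator -/

/-- The constraints on the adjustment weights at the point `x`, given the predictors
`xs 1, …, xs n`. -/
structure IsFeasible {w n : ℕ} (K : E w → ℝ) (h : ℝ) (x : E w) (xs : Fin n → E w)
    (p : Fin n → ℝ) : Prop where
  nonneg : ∀ i, 0 ≤ p i
  sum_one : ∑ i, p i = 1
  balance : ∑ i, (p i * scaledKernel K h (xs i - x)) • (xs i - x) = 0

/-- The empirical log-likelihood `∑ log p_i`, with value `-∞` if some `p_i` is zero. -/
def logLikelihood {n : ℕ} (p : Fin n → ℝ) : EReal := ∑ i, ENNReal.log (ENNReal.ofReal (p i))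

/-- `p` is a vector of adjustment weights: it maximizes the empirical log-likelihood subject to
the constraints. -/
def IsAdjustmentWeights {w n : ℕ} (K : E w → ℝ) (h : ℝ) (x : E w) (xs : Fin n → E w)
    (p : Fin n → ℝ) : Prop :=
  IsFeasible K h x xs p ∧
    ∀ q : Fin n → ℝ, IsFeasible K h x xs q → logLikelihood q ≤ logLikelihood p

/-- The final weights `p_i K_h(X_i - x) / ∑_j p_j K_h(X_j - x)`. -/
def finalWeight {w n : ℕ} (K : E w → ℝ) (h : ℝ) (x : E w) (xs : Fin n → E w)
    (p : Fin n → ℝ) (i : Fin n) : ℝ :=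
  p i * scaledKernel K h (xs i - x) / ∑ j, p j * scaledKernel K h (xs j - x)

/-- The reweighted Nadaraya-Watson estimate of `F(y | x)` built from adjustment weights `p`. -/
def estimator {w n : ℕ} (K : E w → ℝ) (h : ℝ) (x : E w) (xs : Fin n → E w) (ys : Fin n → ℝ)
    (p : Fin n → ℝ) (y : ℝ) : ℝ :=
  ∑ i, finalWeight K h x xs p i * Set.indicator (Set.Iic y) (fun _ => (1 : ℝ)) (ys i)

/-! ### Stochastic order symbols -/

/-- `R_n = o_p(a_n)` for a positive deterministic sequence `a`. -/
def IsLittleOInProb {Ω : Type*} [MeasurableSpace Ω] (μ : Measure Ω) (R : ℕ → Ω → ℝ)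
    (a : ℕ → ℝ) : Prop :=
  ∀ ε : ℝ, 0 < ε → Tendsto (fun n => μ {ω | ε * a n < |R n ω|}) atTop (𝓝 0)

/-- `R_n = O_p(a_n)` for a positive deterministic sequence `a`. -/
def IsBigOInProb {Ω : Type*} [MeasurableSpace Ω] (μ : Measure Ω) (R : ℕ → Ω → ℝ)
    (a : ℕ → ℝ) : Prop :=
  ∀ ε : ℝ, 0 < ε → ∃ M : ℝ, 0 < M ∧
    ∀ᶠ n in atTop, μ {ω | M * a n < |R n ω|} ≤ ENNReal.ofReal ε

end

end RNW

/-!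
Put `u_i = (X_i - x) / h` and `z_i = K(u_i) u_i`. Concavity of the logarithm identifies the
adjustment weights: if `l` solves the empirical multiplier equation `∑ z_i / (1 + ⟪l, z_i⟫) = 0` and
is small, then `p_i = 1 / (n (1 + ⟪l, z_i⟫))`. Since `K` is centred and isotropic, `∑ z_i` is of
smaller order than `n h^w` and `∑ z_i z_iᵀ` is close to a positive multiple of `n h^w` times the
identity. So the dual objective `∑ log (1 + ⟪l, z_i⟫)` has a maximum in the interior of a small ball
with probability tending to one, and such an `l` exists. The estimator is then the average of
`1(Y_i ≤ y)` with weights proportional to `K(u_i) / (1 + ⟪l, z_i⟫)`.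

*Bias.* In the weighted average of `F(X_i)` the balance constraint kills the linear Taylor term, the
law of large numbers for `K(u) (u ⬝ D²F u)` gives the quadratic one, and the tilt is negligible
because `l → 0` in probability.

*Noise.* The multiplier `l` depends on the whole sample, so the average of `1(Y_i ≤ y) - F(X_i)` is
compared with the one in which `l` is replaced by the deterministic solution `l'` of the population
equation `E[z / (1 + ⟪l', z⟫)] = 0`. The latter average is centred, and strong concavity of the dual
objective bounds `‖l - l'‖` by `(n h^w)⁻¹ ‖∑ z_i / (1 + ⟪l', z_i⟫)‖`, again an average of centred
terms. Both are `O_p((n h^w)^(-1/2))`: by the bounded joint densities and `α(τ) = O(τ⁻²)`, a sum of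
bounded functions supported in the window of radius `O(h)` has variance `O(n h^w)`.
-/

namespace RNW

open scoped RealInnerProductSpace

theorem log_one_add_le_sub_sq {t : ℝ} (ht : |t| ≤ 1 / 8) :
    Real.log (1 + t) ≤ t - t ^ 2 / 4 := by
  have taylor := Real.abs_log_sub_add_sum_range_le (x := -t) (by rw [abs_neg]; linarith) 2
  simp only [Finset.sum_range_succ, Finset.sum_range_zero, abs_neg] at taylor
  norm_num at taylor
  have remainder_le : |t| ^ 3 / (1 - |t|) ≤ t ^ 2 / 4 := by
    rw [div_le_iff₀ (by linarith), ← sq_abs t]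
    nlinarith [sq_nonneg (|t|), abs_nonneg t]
  linarith [(abs_le.mp taylor).2]

theorem abs_log_one_add_le {t : ℝ} (ht : |t| ≤ 1 / 8) : |Real.log (1 + t)| ≤ 1 := by
  have taylor := Real.abs_log_sub_add_sum_range_le (x := -t) (by rw [abs_neg]; linarith) 0
  simp only [Finset.range_zero, Finset.sum_empty, zero_add, abs_neg, sub_neg_eq_add,
    pow_one] at taylor
  refine taylor.trans ((div_le_one (by linarith)).mpr (by linarith))

section Multiplier

variable {A F : Type*} [MeasurableSpace A] [NormedAddCommGroup F] [InnerProductSpace ℝ F]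
  {ν : Measure A} {W : A → F} {C r : ℝ}

/-- `l` is a Lagrange multiplier of the empirical likelihood problem with constraint vectors `W a`,
`a` distributed according to `ν`: it solves the first order condition
`∫ W / (1 + ⟪l, W⟫) dν = 0`. The sample problem is the case of the counting measure on `Fin n`. -/
def IsMultiplier (ν : Measure A) (W : A → F) (l : F) : Prop :=
  ∫ a, (1 + ⟪l, W a⟫)⁻¹ • W a ∂ν = 0

theorem isMultiplier_count_iff [CompleteSpace F] {n : ℕ} {z : Fin n → F} {l : F} :
    IsMultiplier Measure.count z l ↔ ∑ i, (1 + ⟪l, z i⟫)⁻¹ • z i = 0 := by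
  rw [IsMultiplier, integral_count]

/-- The dual of the empirical likelihood problem; its critical points are the Lagrange
multipliers. -/
noncomputable def dualObjective (ν : Measure A) (W : A → F) (l : F) : ℝ :=
  ∫ a, Real.log (1 + ⟪l, W a⟫) ∂ν

theorem abs_inner_le_of_norm_le {l z : F} (hz : ‖z‖ ≤ C) (hl : ‖l‖ ≤ r) (hrC : r * C ≤ 1 / 8) :
    |⟪l, z⟫| ≤ 1 / 8 :=
  calc |⟪l, z⟫| ≤ ‖l‖ * ‖z‖ := abs_real_inner_le_norm l z
    _ ≤ r * C := mul_le_mul hl hz (norm_nonneg z) ((norm_nonneg l).trans hl)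
    _ ≤ 1 / 8 := hrC

theorem seven_eighths_le_one_add_inner {l z : F} (hz : ‖z‖ ≤ C) (hl : ‖l‖ ≤ r)
    (hrC : r * C ≤ 1 / 8) : 7 / 8 ≤ 1 + ⟪l, z⟫ := by
  linarith [(abs_le.mp (abs_inner_le_of_norm_le hz hl hrC)).1]

theorem aestronglyMeasurable_log_one_add_inner (hW : AEStronglyMeasurable W ν) (l : F) :
    AEStronglyMeasurable (fun a => Real.log (1 + ⟪l, W a⟫)) ν :=
  (Real.measurable_log.comp_aemeasurable
    ((aestronglyMeasurable_const.inner hW).aemeasurable.const_add 1)).aestronglyMeasurable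

theorem continuousOn_dualObjective [IsFiniteMeasure ν] (hW : AEStronglyMeasurable W ν)
    (hC : ∀ a, ‖W a‖ ≤ C) (hrC : r * C ≤ 1 / 8) :
    ContinuousOn (dualObjective ν W) (Metric.closedBall 0 r) := by
  refine continuousOn_of_dominated (bound := fun _ => 1)
    (fun l _ => aestronglyMeasurable_log_one_add_inner hW l)
    (fun l hl => Eventually.of_forall fun a => ?_) (integrable_const _)
    (Eventually.of_forall fun a => ContinuousOn.log (by fun_prop) fun l hl => ?_)
  · exact abs_log_one_add_le (abs_inner_le_of_norm_le (hC a) (mem_closedBall_zero_iff.mp hl) hrC)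
  · linarith [seven_eighths_le_one_add_inner (hC a) (mem_closedBall_zero_iff.mp hl) hrC]

theorem dualObjective_le [IsFiniteMeasure ν] [CompleteSpace F] (hW : AEStronglyMeasurable W ν)
    (hC : ∀ a, ‖W a‖ ≤ C) (hrC : r * C ≤ 1 / 8) {l : F} (hl : ‖l‖ ≤ r) :
    dualObjective ν W l ≤ ⟪l, ∫ a, W a ∂ν⟫ - (∫ a, ⟪l, W a⟫ ^ 2 ∂ν) / 4 := by
  have inner_small : ∀ a, |⟪l, W a⟫| ≤ 1 / 8 := fun a => abs_inner_le_of_norm_le (hC a) hl hrC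
  have measurable_inner : AEStronglyMeasurable (fun a => ⟪l, W a⟫) ν :=
    aestronglyMeasurable_const.inner hW
  have integrable_inner : Integrable (fun a => ⟪l, W a⟫) ν :=
    Integrable.of_bound measurable_inner (1 / 8) (Eventually.of_forall inner_small)
  have integrable_sq : Integrable (fun a => ⟪l, W a⟫ ^ 2) ν :=
    Integrable.of_bound (measurable_inner.pow 2) ((1 / 8) ^ 2) (Eventually.of_forall fun a => by
      rw [norm_pow]
      exact pow_le_pow_left₀ (norm_nonneg _) (inner_small a) 2)
  rw [← integral_inner (Integrable.of_bound hW C (Eventually.of_forall hC)), ← integral_div,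
    ← integral_sub integrable_inner (integrable_sq.div_const 4)]
  refine integral_mono (Integrable.of_bound (aestronglyMeasurable_log_one_add_inner hW l) 1
    (Eventually.of_forall fun a => abs_log_one_add_le (inner_small a)))
    (integrable_inner.sub (integrable_sq.div_const 4)) fun a => ?_
  exact log_one_add_le_sub_sq (inner_small a)

theorem norm_inv_one_add_inner_smul_le {l z : F} (hz : ‖z‖ ≤ C) (hl : ‖l‖ ≤ r)
    (hrC : r * C ≤ 1 / 8) : ‖(1 + ⟪l, z⟫)⁻¹ • z‖ ≤ 2 * C := by
  have one_le := seven_eighths_le_one_add_inner hz hl hrC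
  rw [norm_smul, norm_inv, Real.norm_of_nonneg (by linarith)]
  exact mul_le_mul (inv_le_of_inv_le₀ two_pos (by linarith)) hz (norm_nonneg z) two_pos.le

theorem integrable_inv_one_add_inner_smul [IsFiniteMeasure ν] (hW : AEStronglyMeasurable W ν)
    (hC : ∀ a, ‖W a‖ ≤ C) (hrC : r * C ≤ 1 / 8) {l : F} (hl : ‖l‖ ≤ r) :
    Integrable (fun a => (1 + ⟪l, W a⟫)⁻¹ • W a) ν :=
  Integrable.of_bound
    (((aestronglyMeasurable_const.inner hW).aemeasurable.const_add
      1).inv.aestronglyMeasurable.smul hW) (2 * C)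
    (Eventually.of_forall fun a => norm_inv_one_add_inner_smul_le (hC a) hl hrC)

theorem hasFDerivAt_dualObjective [IsFiniteMeasure ν] [CompleteSpace F]
    (hW : AEStronglyMeasurable W ν) (hC : ∀ a, ‖W a‖ ≤ C) (hrC : r * C ≤ 1 / 8) {l : F}
    (hl : ‖l‖ < r) :
    HasFDerivAt (dualObjective ν W) (innerSL ℝ (∫ a, (1 + ⟪l, W a⟫)⁻¹ • W a ∂ν)) l := by
  have integrable_gradient := integrable_inv_one_add_inner_smul hW hC hrC hl.le
  have ball_mem : Metric.ball 0 r ∈ 𝓝 l := Metric.isOpen_ball.mem_nhds (mem_ball_zero_iff.mpr hl)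
  rw [← (innerSL ℝ).integral_comp_comm integrable_gradient]
  refine hasFDerivAt_integral_of_dominated_of_fderiv_le (bound := fun _ => 2 * C)
    (F' := fun l a => innerSL ℝ ((1 + ⟪l, W a⟫)⁻¹ • W a)) ball_mem
    (Eventually.of_forall (aestronglyMeasurable_log_one_add_inner hW))
    (Integrable.of_bound (aestronglyMeasurable_log_one_add_inner hW l) 1
      (Eventually.of_forall fun a =>
        abs_log_one_add_le (abs_inner_le_of_norm_le (hC a) hl.le hrC)))
    ((innerSL ℝ).integrable_comp integrable_gradient).aestronglyMeasurable
    (Eventually.of_forall fun a l' hl' => ?_) (integrable_const _)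
    (Eventually.of_forall fun a l' hl' => ?_)
  · rw [innerSL_apply_norm]
    exact norm_inv_one_add_inner_smul_le (hC a) (mem_ball_zero_iff.mp hl').le hrC
  · have one_le := seven_eighths_le_one_add_inner (hC a) (mem_ball_zero_iff.mp hl').le hrC
    have hasFDerivAt_inner : HasFDerivAt (fun l => 1 + ⟪l, W a⟫) (innerSL ℝ (W a)) l' := by
      simpa only [innerSL_apply_apply, real_inner_comm] using
        ((innerSL ℝ (W a)).hasFDerivAt (x := l')).const_add 1
    rw [map_smul]
    exact hasFDerivAt_inner.log (by linarith)

/-- On the sphere of radius `r` the quadratic term of the dual objective outweighs the linear one,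
so its maximum over the ball is attained in the interior. -/
theorem exists_isMultiplier [IsFiniteMeasure ν] [ProperSpace F] (hW : AEStronglyMeasurable W ν)
    {v : ℝ} (hC : ∀ a, ‖W a‖ ≤ C) (hr : 0 < r) (hrC : r * C ≤ 1 / 8)
    (hmean : ‖∫ a, W a ∂ν‖ < v * r / 4)
    (hquad : ∀ e : F, v * ‖e‖ ^ 2 ≤ ∫ a, ⟪e, W a⟫ ^ 2 ∂ν) :
    ∃ l : F, ‖l‖ < r ∧ IsMultiplier ν W l := by
  have neg_on_sphere : ∀ l ∈ Metric.closedBall (0 : F) r \ Metric.ball 0 r,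
      dualObjective ν W l < dualObjective ν W 0 := by
    rintro l ⟨hl, hl'⟩
    have norm_eq : ‖l‖ = r :=
      le_antisymm (mem_closedBall_zero_iff.mp hl) (not_lt.mp (mt mem_ball_zero_iff.mpr hl'))
    have linear_le : ⟪l, ∫ a, W a ∂ν⟫ ≤ r * ‖∫ a, W a ∂ν‖ := norm_eq ▸ real_inner_le_norm _ _
    have quad := hquad l
    rw [norm_eq] at quad
    calc dualObjective ν W l ≤ ⟪l, ∫ a, W a ∂ν⟫ - (∫ a, ⟪l, W a⟫ ^ 2 ∂ν) / 4 :=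
          dualObjective_le hW hC hrC norm_eq.le
      _ ≤ r * (‖∫ a, W a ∂ν‖ - v * r / 4) := by linarith
      _ < 0 := mul_neg_of_pos_of_neg hr (sub_neg.mpr hmean)
      _ = dualObjective ν W 0 := by simp [dualObjective]
  obtain ⟨l, hl, hmax⟩ := (isCompact_closedBall (0 : F) r).exists_isLocalMax_mem_open
    Metric.ball_subset_closedBall (continuousOn_dualObjective hW hC hrC)
    (Metric.mem_closedBall_self hr.le) neg_on_sphere Metric.isOpen_ball
  have norm_lt : ‖l‖ < r := mem_ball_zero_iff.mp hl
  have fderiv_eq_zero := hmax.hasFDerivAt_eq_zero (hasFDerivAt_dualObjective hW hC hrC norm_lt)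
  exact ⟨l, norm_lt, by rw [IsMultiplier, ← norm_eq_zero, ← innerSL_apply_norm ℝ, fderiv_eq_zero,
    norm_zero]⟩

/-- The map `l ↦ ∑ zᵢ / (1 + ⟪l, zᵢ⟫)` is strongly monotone (with a sign) on the ball, so a
multiplier is close to any point where that map is small. -/
theorem norm_sub_le_of_isMultiplier_count [CompleteSpace F] {n : ℕ} {z : Fin n → F} {v : ℝ}
    (hC : ∀ i, ‖z i‖ ≤ C) (hrC : r * C ≤ 1 / 8) {l l' : F} (hl : ‖l‖ ≤ r) (hl' : ‖l'‖ ≤ r)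
    (hmul : IsMultiplier Measure.count z l)
    (hquad : ∀ e : F, v * ‖e‖ ^ 2 ≤ ∑ i, ⟪e, z i⟫ ^ 2) :
    v * ‖l - l'‖ ≤ 2 * ‖∑ i, (1 + ⟪l', z i⟫)⁻¹ • z i‖ := by
  rcases eq_or_ne l l' with rfl | hne
  · simp
  have norm_sub_pos : 0 < ‖l - l'‖ := norm_pos_iff.mpr (sub_ne_zero.mpr hne)
  have monotone : ∀ i, ⟪l - l', z i⟫ ^ 2 ≤
      2 * (⟪l - l', (1 + ⟪l', z i⟫)⁻¹ • z i⟫ - ⟪l - l', (1 + ⟪l, z i⟫)⁻¹ • z i⟫) := fun i => by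
    have ha := abs_le.mp (abs_inner_le_of_norm_le (hC i) hl hrC)
    have hb := abs_le.mp (abs_inner_le_of_norm_le (hC i) hl' hrC)
    rw [real_inner_smul_right, real_inner_smul_right, inner_sub_left]
    generalize ⟪l, z i⟫ = a at *
    generalize ⟪l', z i⟫ = b at *
    have difference_eq : (1 + b)⁻¹ * (a - b) - (1 + a)⁻¹ * (a - b) =
        (a - b) ^ 2 / ((1 + b) * (1 + a)) := by
      field_simp [(by linarith : 1 + a ≠ 0), (by linarith : 1 + b ≠ 0)]
      ring
    rw [difference_eq, ← mul_div_assoc, le_div_iff₀ (by nlinarith)]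
    nlinarith [mul_le_mul_of_nonneg_left (by nlinarith : (1 + b) * (1 + a) ≤ 2)
      (sq_nonneg (a - b))]
  have sq_le := calc
    v * ‖l - l'‖ ^ 2 ≤ ∑ i, ⟪l - l', z i⟫ ^ 2 := hquad _
    _ ≤ 2 * (⟪l - l', ∑ i, (1 + ⟪l', z i⟫)⁻¹ • z i⟫ - ⟪l - l', ∑ i, (1 + ⟪l, z i⟫)⁻¹ • z i⟫) := by
      rw [inner_sum, inner_sum, ← Finset.sum_sub_distrib, Finset.mul_sum]
      exact Finset.sum_le_sum fun i _ => monotone i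
    _ = 2 * ⟪l - l', ∑ i, (1 + ⟪l', z i⟫)⁻¹ • z i⟫ := by
      rw [isMultiplier_count_iff.mp hmul, inner_zero_right, sub_zero]
    _ ≤ 2 * (‖l - l'‖ * ‖∑ i, (1 + ⟪l', z i⟫)⁻¹ • z i‖) := by
      gcongr
      exact real_inner_le_norm _ _
  nlinarith

end Multiplier

section AdjustmentWeights

variable {w n : ℕ}

theorem logLikelihood_of_pos {q : Fin n → ℝ} (hq : ∀ i, 0 < q i) :
    logLikelihood q = ((∑ i, Real.log (q i) : ℝ) : EReal) := by
  have coe_sum : ((∑ i, Real.log (q i) : ℝ) : EReal) = ∑ i, (Real.log (q i) : EReal) :=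
    map_sum (⟨⟨Real.toEReal, EReal.coe_zero⟩, EReal.coe_add⟩ : ℝ →+ EReal) _ _
  rw [coe_sum, logLikelihood]
  refine Finset.sum_congr rfl fun i _ => ?_
  rw [ENNReal.log_ofReal, if_neg (not_le.mpr (hq i))]

theorem pos_of_logLikelihood_ne_bot {q : Fin n → ℝ} (hq : logLikelihood q ≠ ⊥) (i : Fin n) :
    0 < q i := by
  contrapose! hq
  rw [logLikelihood, ← Finset.add_sum_erase _ _ (Finset.mem_univ i), ENNReal.log_ofReal,
    if_pos hq, EReal.bot_add]

theorem log_sub_log_le_div_sub_one {a b : ℝ} (ha : 0 < a) (hb : 0 < b) :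
    Real.log a - Real.log b ≤ a / b - 1 := by
  rw [← Real.log_div ha.ne' hb.ne']
  exact Real.log_le_sub_one_of_pos (div_pos ha hb)

theorem logLikelihood_le_of_sum_div_eq {p q : Fin n → ℝ} (hq : ∀ i, 0 < q i)
    (hpq : ∑ i, p i / q i = n) : logLikelihood p ≤ logLikelihood q := by
  by_cases hbot : logLikelihood p = ⊥
  · exact hbot ▸ bot_le
  have hp := pos_of_logLikelihood_ne_bot hbot
  rw [logLikelihood_of_pos hp, logLikelihood_of_pos hq, EReal.coe_le_coe_iff, ← sub_nonpos,
    ← Finset.sum_sub_distrib]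
  calc ∑ i, (Real.log (p i) - Real.log (q i)) ≤ ∑ i, (p i / q i - 1) :=
        Finset.sum_le_sum fun i _ => log_sub_log_le_div_sub_one (hp i) (hq i)
    _ = 0 := by simp [hpq]

theorem eq_of_logLikelihood_le_of_sum_div_eq {p q : Fin n → ℝ} (hq : ∀ i, 0 < q i)
    (hpq : ∑ i, p i / q i = n) (hle : logLikelihood q ≤ logLikelihood p) : p = q := by
  have hp := pos_of_logLikelihood_ne_bot (q := p) fun hbot => by
    rw [hbot, logLikelihood_of_pos hq] at hle
    exact EReal.coe_ne_bot _ (le_bot_iff.mp hle)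
  rw [logLikelihood_of_pos hp, logLikelihood_of_pos hq, EReal.coe_le_coe_iff, ← sub_nonneg,
    ← Finset.sum_sub_distrib] at hle
  have gap_nonneg : ∀ i, 0 ≤ p i / q i - 1 - (Real.log (p i) - Real.log (q i)) := fun i =>
    sub_nonneg.mpr (log_sub_log_le_div_sub_one (hp i) (hq i))
  have sum_gap_eq_zero : ∑ i, (p i / q i - 1 - (Real.log (p i) - Real.log (q i))) = 0 := by
    refine le_antisymm ?_ (Finset.sum_nonneg fun i _ => gap_nonneg i)
    rw [Finset.sum_sub_distrib, Finset.sum_sub_distrib, hpq]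
    simpa using hle
  funext i
  by_contra hne
  have gap_eq_zero := (Finset.sum_eq_zero_iff_of_nonneg fun i _ => gap_nonneg i).mp
    sum_gap_eq_zero i (Finset.mem_univ i)
  have gap_pos := Real.log_lt_sub_one_of_pos (div_pos (hp i) (hq i))
    (mt (div_eq_one_iff_eq (hq i).ne').mp hne)
  rw [Real.log_div (hp i).ne' (hq i).ne'] at gap_pos
  linarith

/-- The coordinate `(z - x) / h` of `z` in the window of width `h` around `x`. -/
noncomputable def zoom (h : ℝ) (x z : E w) : E w := h⁻¹ • (z - x)

/-- The vector `K(u) u`, whose average is the balance constraint of the adjustment weights in the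
coordinates `u = zoom h x z`. -/
noncomputable def kernelScore (K : E w → ℝ) (u : E w) : E w := K u • u

theorem isFeasible_iff {K : E w → ℝ} {h : ℝ} (hh : 0 < h) {x : E w} {xs : Fin n → E w}
    {p : Fin n → ℝ} :
    IsFeasible K h x xs p ↔ (∀ i, 0 ≤ p i) ∧ ∑ i, p i = 1 ∧
      ∑ i, p i • kernelScore K (zoom h x (xs i)) = 0 := by
  have balance_iff : ∑ i, (p i * scaledKernel K h (xs i - x)) • (xs i - x) = 0 ↔
      ∑ i, p i • kernelScore K (zoom h x (xs i)) = 0 := by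
    have factor : ∑ i, (p i * scaledKernel K h (xs i - x)) • (xs i - x) =
        ((h ^ w)⁻¹ * h) • ∑ i, p i • kernelScore K (zoom h x (xs i)) := by
      rw [Finset.smul_sum]
      refine Finset.sum_congr rfl fun i _ => ?_
      simp only [kernelScore, zoom, scaledKernel, smul_smul]
      congr 1
      field_simp
    rw [factor, smul_eq_zero_iff_right (by positivity)]
  rw [← balance_iff]
  exact ⟨fun hp => ⟨hp.nonneg, hp.sum_one, hp.balance⟩, fun hp => ⟨hp.1, hp.2.1, hp.2.2⟩⟩

section MultiplierWeight

variable {F : Type*} [NormedAddCommGroup F] [InnerProductSpace ℝ F] {z : Fin n → F} {l : F}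

/-- The empirical likelihood weights with constraint vectors `z` and Lagrange multiplier `l`. -/
noncomputable def multiplierWeight (z : Fin n → F) (l : F) (i : Fin n) : ℝ :=
  (n * (1 + ⟪l, z i⟫))⁻¹

theorem multiplierWeight_pos (hl : ∀ i, 0 < 1 + ⟪l, z i⟫) (i : Fin n) :
    0 < multiplierWeight z l i :=
  inv_pos.mpr (mul_pos (Nat.cast_pos.mpr i.pos) (hl i))

theorem sum_div_multiplierWeight_eq {p : Fin n → ℝ} (hsum : ∑ i, p i = 1)
    (hbal : ∑ i, p i • z i = 0) : ∑ i, p i / multiplierWeight z l i = n := by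
  have inner_eq_zero : ∑ i, p i * ⟪l, z i⟫ = 0 := by
    simpa [inner_sum, real_inner_smul_right] using congrArg (fun v => ⟪l, v⟫) hbal
  calc ∑ i, p i / multiplierWeight z l i = ∑ i, (n * p i + n * (p i * ⟪l, z i⟫)) := by
        refine Finset.sum_congr rfl fun i _ => ?_
        rw [multiplierWeight, div_inv_eq_mul]
        ring
    _ = n := by
        rw [Finset.sum_add_distrib, ← Finset.mul_sum, ← Finset.mul_sum, hsum, inner_eq_zero]
        ring

variable [CompleteSpace F]

theorem sum_multiplierWeight_smul (hmul : IsMultiplier Measure.count z l) :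
    ∑ i, multiplierWeight z l i • z i = 0 := by
  simp only [multiplierWeight, mul_inv, mul_smul]
  rw [← Finset.smul_sum, isMultiplier_count_iff.mp hmul, smul_zero]

theorem sum_multiplierWeight (hn : n ≠ 0) (hl : ∀ i, 0 < 1 + ⟪l, z i⟫)
    (hmul : IsMultiplier Measure.count z l) : ∑ i, multiplierWeight z l i = 1 := by
  have inner_eq_zero : ∑ i, multiplierWeight z l i * ⟪l, z i⟫ = 0 := by
    simpa [inner_sum, real_inner_smul_right] using
      congrArg (fun v => ⟪l, v⟫) (sum_multiplierWeight_smul hmul)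
  calc ∑ i, multiplierWeight z l i
      = ∑ i, ((n : ℝ)⁻¹ - multiplierWeight z l i * ⟪l, z i⟫) := by
        refine Finset.sum_congr rfl fun i _ => ?_
        have := (hl i).ne'
        rw [multiplierWeight]
        field_simp
        ring
    _ = 1 := by
        rw [Finset.sum_sub_distrib, inner_eq_zero]
        simp [hn]

end MultiplierWeight

theorem isAdjustmentWeights_multiplierWeight {K : E w → ℝ} {h : ℝ} (hh : 0 < h) {x : E w}
    {xs : Fin n → E w} (hn : n ≠ 0) {l : E w}
    (hl : ∀ i, 0 < 1 + ⟪l, kernelScore K (zoom h x (xs i))⟫)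
    (hmul : IsMultiplier Measure.count (fun i => kernelScore K (zoom h x (xs i))) l) :
    IsAdjustmentWeights K h x xs
      (multiplierWeight (fun i => kernelScore K (zoom h x (xs i))) l) := by
  refine ⟨(isFeasible_iff hh).mpr ⟨fun i => (multiplierWeight_pos hl i).le,
    sum_multiplierWeight hn hl hmul, sum_multiplierWeight_smul hmul⟩, fun p hp => ?_⟩
  obtain ⟨-, hsum, hbal⟩ := (isFeasible_iff hh).mp hp
  exact logLikelihood_le_of_sum_div_eq (multiplierWeight_pos hl)
    (sum_div_multiplierWeight_eq hsum hbal)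

theorem IsAdjustmentWeights.eq_multiplierWeight {K : E w → ℝ} {h : ℝ} (hh : 0 < h) {x : E w}
    {xs : Fin n → E w} (hn : n ≠ 0) {l : E w}
    (hl : ∀ i, 0 < 1 + ⟪l, kernelScore K (zoom h x (xs i))⟫)
    (hmul : IsMultiplier Measure.count (fun i => kernelScore K (zoom h x (xs i))) l)
    {p : Fin n → ℝ} (hp : IsAdjustmentWeights K h x xs p) :
    p = multiplierWeight (fun i => kernelScore K (zoom h x (xs i))) l := by
  obtain ⟨-, hsum, hbal⟩ := (isFeasible_iff hh).mp hp.1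
  exact eq_of_logLikelihood_le_of_sum_div_eq (multiplierWeight_pos hl)
    (sum_div_multiplierWeight_eq hsum hbal)
    (hp.2 _ (isAdjustmentWeights_multiplierWeight hh hn hl hmul).1)

end AdjustmentWeights

section Covariance

variable {Ω : Type*} {mΩ : MeasurableSpace Ω} {μ : Measure Ω}

theorem integral_abs_eq_two_mul_setIntegral_pos {d : Ω → ℝ} (hd : Integrable d μ)
    (hpos : MeasurableSet {ω | 0 < d ω}) (hzero : ∫ ω, d ω ∂μ = 0) :
    ∫ ω, |d ω| ∂μ = 2 * ∫ ω in {ω | 0 < d ω}, d ω ∂μ := by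
  suffices ∫ ω, |d ω| ∂μ = ∫ ω, (2 * {ω | 0 < d ω}.indicator d ω - d ω) ∂μ by
    rw [this, integral_sub ((hd.indicator hpos).const_mul 2) hd, hzero, sub_zero,
      integral_const_mul, integral_indicator hpos]
  refine integral_congr_ae (Eventually.of_forall fun ω => ?_)
  by_cases hω : 0 < d ω
  · simp only [Set.indicator_of_mem (show ω ∈ {ω | 0 < d ω} from hω), abs_of_pos hω]; ring
  · simp only [Set.indicator_of_notMem (show ω ∉ {ω | 0 < d ω} from hω),
      abs_of_nonpos (not_lt.mp hω)]; ring

theorem abs_integral_le_of_eq_zero_off [IsFiniteMeasure μ] {f : Ω → ℝ} {C : ℝ} {A : Set Ω}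
    (hfC : ∀ ω, |f ω| ≤ C) (hfA : ∀ ω, ω ∉ A → f ω = 0) : |∫ ω, f ω ∂μ| ≤ C * μ.real A := by
  rw [← setIntegral_eq_integral_of_forall_compl_eq_zero hfA]
  exact norm_setIntegral_le_of_norm_le_const (f := f) (measure_lt_top μ A) fun ω _ => hfC ω

variable [IsProbabilityMeasure μ]

theorem covariance_eq_integral_mul_condExp {m : MeasurableSpace Ω} (hm : m ≤ mΩ) {f g : Ω → ℝ}
    {C : ℝ} (hf : StronglyMeasurable[m] f) (hfC : ∀ ω, |f ω| ≤ C) (hg : Integrable g μ) :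
    cov[f, g; μ] = ∫ ω, f ω * μ[fun ω => g ω - μ[g] | m] ω ∂μ := by
  have hcentered : Integrable (fun ω => g ω - μ[g]) μ := hg.sub (integrable_const _)
  have hprod : Integrable (f * fun ω => g ω - μ[g]) μ :=
    hcentered.bdd_mul (hf.mono hm).aestronglyMeasurable (Eventually.of_forall hfC)
  have hmean : ∫ ω, (g ω - μ[g]) ∂μ = 0 := by
    rw [integral_sub hg (integrable_const _)]
    simp
  calc cov[f, g; μ] = ∫ ω, (f * fun ω => g ω - μ[g]) ω ∂μ - μ[f] * ∫ ω, (g ω - μ[g]) ∂μ := by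
        rw [← integral_const_mul, ← integral_sub hprod (hcentered.const_mul _)]
        exact integral_congr_ae (Eventually.of_forall fun ω => by simp only [Pi.mul_apply]; ring)
    _ = ∫ ω, μ[f * fun ω => g ω - μ[g] | m] ω ∂μ := by
        rw [hmean, mul_zero, sub_zero, integral_condExp hm]
    _ = ∫ ω, f ω * μ[fun ω => g ω - μ[g] | m] ω ∂μ :=
        integral_congr_ae (condExp_mul_of_stronglyMeasurable_left hf hprod hcentered)

theorem covariance_indicator_one {A B : Set Ω} (hA : MeasurableSet A) (hB : MeasurableSet B) :
    cov[A.indicator 1, B.indicator 1; μ] = μ.real (A ∩ B) - μ.real A * μ.real B := by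
  have hLp : ∀ D : Set Ω, MeasurableSet D → MemLp (D.indicator (1 : Ω → ℝ)) 2 μ := fun D hD =>
    (memLp_const (1 : ℝ)).indicator hD
  rw [covariance_eq_sub (hLp A hA) (hLp B hB), ← Set.inter_indicator_one,
    integral_indicator_one (hA.inter hB), integral_indicator_one hA, integral_indicator_one hB]

theorem exists_abs_covariance_le {m : MeasurableSpace Ω} (hm : m ≤ mΩ) {f g : Ω → ℝ} {C : ℝ}
    (hf : StronglyMeasurable[m] f) (hfC : ∀ ω, |f ω| ≤ C) (hg : Integrable g μ) :
    ∃ A, MeasurableSet[m] A ∧ |cov[f, g; μ]| ≤ 2 * C * |cov[A.indicator 1, g; μ]| := by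
  set d : Ω → ℝ := μ[fun ω => g ω - μ[g] | m]
  have hdm : StronglyMeasurable[m] d := stronglyMeasurable_condExp
  have hdi : Integrable d μ := integrable_condExp
  have hA : MeasurableSet[m] {ω | 0 < d ω} := measurableSet_lt measurable_const hdm.measurable
  have hzero : ∫ ω, d ω ∂μ = 0 := by
    rw [integral_condExp hm, integral_sub hg (integrable_const _)]
    simp
  have hcovA : cov[{ω | 0 < d ω}.indicator 1, g; μ] = ∫ ω in {ω | 0 < d ω}, d ω ∂μ := by
    rw [covariance_eq_integral_mul_condExp hm (C := 1) (stronglyMeasurable_one.indicator hA) _ hg,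
      ← integral_indicator (hm _ hA)]
    · refine integral_congr_ae (Eventually.of_forall fun ω => ?_)
      simp [Set.indicator_apply, d]
    · intro ω
      by_cases hω : 0 < d ω <;> simp [hω]
  have hC : 0 ≤ C := by
    obtain ⟨ω⟩ : Nonempty Ω := nonempty_of_isProbabilityMeasure μ
    exact (abs_nonneg _).trans (hfC ω)
  refine ⟨_, hA, ?_⟩
  calc |cov[f, g; μ]| = |∫ ω, f ω * d ω ∂μ| := by
        rw [covariance_eq_integral_mul_condExp hm hf hfC hg]
    _ ≤ ∫ ω, C * |d ω| ∂μ := by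
        refine norm_integral_le_of_norm_le (f := fun ω => f ω * d ω) (hdi.abs.const_mul C)
          (Eventually.of_forall fun ω => ?_)
        rw [Real.norm_eq_abs, abs_mul]
        exact mul_le_mul_of_nonneg_right (hfC ω) (abs_nonneg _)
    _ = 2 * C * cov[{ω | 0 < d ω}.indicator 1, g; μ] := by
        rw [integral_const_mul, integral_abs_eq_two_mul_setIntegral_pos hdi (hm _ hA) hzero, hcovA]
        ring
    _ ≤ _ := by
        gcongr
        exact le_abs_self _

/-- Truncating to the sign of a conditional expectation, once for each of the two functions,
reduces the covariance to that of two events. -/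
theorem abs_covariance_le_of_mixing {m₁ m₂ : MeasurableSpace Ω} (hm₁ : m₁ ≤ mΩ) (hm₂ : m₂ ≤ mΩ)
    {f g : Ω → ℝ} {C C' a : ℝ} (hf : StronglyMeasurable[m₁] f) (hfC : ∀ ω, |f ω| ≤ C)
    (hg : StronglyMeasurable[m₂] g) (hgC : ∀ ω, |g ω| ≤ C')
    (ha : ∀ A B, MeasurableSet[m₁] A → MeasurableSet[m₂] B →
      |μ.real (A ∩ B) - μ.real A * μ.real B| ≤ a) :
    |cov[f, g; μ]| ≤ 4 * C * C' * a := by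
  obtain ⟨ω⟩ : Nonempty Ω := nonempty_of_isProbabilityMeasure μ
  have hC : 0 ≤ C := (abs_nonneg _).trans (hfC ω)
  have hC' : 0 ≤ C' := (abs_nonneg _).trans (hgC ω)
  have hgi : Integrable g μ := Integrable.of_bound (hg.mono hm₂).aestronglyMeasurable C'
    (Eventually.of_forall hgC)
  obtain ⟨A, hA, hfA⟩ := exists_abs_covariance_le hm₁ hf hfC hgi
  have hAi : Integrable (A.indicator (1 : Ω → ℝ)) μ := (integrable_const 1).indicator (hm₁ _ hA)
  obtain ⟨B, hB, hgB⟩ := exists_abs_covariance_le hm₂ hg hgC hAi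
  rw [covariance_comm, covariance_comm (B.indicator 1),
    covariance_indicator_one (hm₁ _ hA) (hm₂ _ hB)] at hgB
  calc |cov[f, g; μ]| ≤ 2 * C * |cov[A.indicator 1, g; μ]| := hfA
    _ ≤ 2 * C * (2 * C' * a) := by
        gcongr
        exact hgB.trans (by gcongr; exact ha A B hA hB)
    _ = _ := by ring

theorem abs_covariance_le_of_eq_zero_off {f g : Ω → ℝ} {C : ℝ} {A B : Set Ω}
    (hf : AEStronglyMeasurable f μ) (hg : AEStronglyMeasurable g μ)
    (hfC : ∀ ω, |f ω| ≤ C) (hgC : ∀ ω, |g ω| ≤ C) (hfA : ∀ ω, ω ∉ A → f ω = 0)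
    (hgB : ∀ ω, ω ∉ B → g ω = 0) :
    |cov[f, g; μ]| ≤ C ^ 2 * (μ.real (A ∩ B) + μ.real A * μ.real B) := by
  obtain ⟨ω⟩ : Nonempty Ω := nonempty_of_isProbabilityMeasure μ
  have hC : 0 ≤ C := (abs_nonneg _).trans (hfC ω)
  have hprod : |∫ ω, (f * g) ω ∂μ| ≤ C * C * μ.real (A ∩ B) := by
    refine abs_integral_le_of_eq_zero_off (fun ω => ?_) fun ω hω => ?_
    · rw [Pi.mul_apply, abs_mul]
      exact mul_le_mul (hfC ω) (hgC ω) (abs_nonneg _) hC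
    · by_cases hωA : ω ∈ A
      · simp [hgB ω fun hωB => hω ⟨hωA, hωB⟩]
      · simp [hfA ω hωA]
  rw [covariance_eq_sub (MemLp.of_bound hf C (Eventually.of_forall hfC))
    (MemLp.of_bound hg C (Eventually.of_forall hgC))]
  calc |∫ ω, (f * g) ω ∂μ - (∫ ω, f ω ∂μ) * ∫ ω, g ω ∂μ|
      ≤ |∫ ω, (f * g) ω ∂μ| + |∫ ω, f ω ∂μ| * |∫ ω, g ω ∂μ| :=
        (abs_sub _ _).trans_eq (by rw [abs_mul])
    _ ≤ C * C * μ.real (A ∩ B) + C * μ.real A * (C * μ.real B) := by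
        gcongr
        · exact abs_integral_le_of_eq_zero_off hfC hfA
        · exact abs_integral_le_of_eq_zero_off hgC hgB
    _ = _ := by ring

end Covariance

section Mixing

variable {Ω S : Type*} {mΩ : MeasurableSpace Ω} [MeasurableSpace S] {μ : Measure Ω} {V : ℕ → Ω → S}

theorem IsStationary.map_prodMk_eq (hs : IsStationary μ V) (hV : ∀ i, Measurable (V i))
    (i τ : ℕ) : μ.map (fun ω => (V i ω, V (i + τ) ω)) = μ.map (fun ω => (V 0 ω, V τ ω)) := by
  have hpair : Measurable fun v : ℕ → S => (v 0, v τ) :=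
    (measurable_pi_apply 0).prodMk (measurable_pi_apply τ)
  have h := congrArg (Measure.map fun v : ℕ → S => (v 0, v τ)) (hs i)
  rw [Measure.map_map hpair (measurable_pi_lambda _ fun j => hV _),
    Measure.map_map hpair (measurable_pi_lambda _ fun j => hV _)] at h
  simpa [Function.comp_def, add_comm] using h

theorem IsStationary.identDistrib (hs : IsStationary μ V) (hV : ∀ i, Measurable (V i)) (i : ℕ) :
    IdentDistrib (V i) (V 0) μ μ :=
  have hpair : IdentDistrib (fun ω => (V i ω, V (i + 0) ω)) (fun ω => (V 0 ω, V 0 ω)) μ μ :=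
    ⟨((hV i).prodMk (hV (i + 0))).aemeasurable, ((hV 0).prodMk (hV 0)).aemeasurable,
      hs.map_prodMk_eq hV i 0⟩
  hpair.comp measurable_fst

theorem IsStationary.covariance_eq (hs : IsStationary μ V) (hV : ∀ i, Measurable (V i))
    {f : S → ℝ} (hf : Measurable f) (i τ : ℕ) :
    cov[fun ω => f (V i ω), fun ω => f (V (i + τ) ω); μ] =
      cov[fun ω => f (V 0 ω), fun ω => f (V τ ω); μ] := by
  have hcov : ∀ j, cov[fun ω => f (V j ω), fun ω => f (V (j + τ) ω); μ] =
      cov[fun z : S × S => f z.1, fun z => f z.2; μ.map fun ω => (V j ω, V (j + τ) ω)] := fun j =>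
    (covariance_map_fun (hf.comp measurable_fst).aestronglyMeasurable
      (hf.comp measurable_snd).aestronglyMeasurable ((hV j).prodMk (hV _)).aemeasurable).symm
  rw [hcov, hs.map_prodMk_eq hV, ← zero_add τ, hcov, zero_add]

theorem exists_alphaMixing_le
    (hrate : alphaMixing μ V =O[atTop] fun τ : ℕ => ((τ : ℝ) ^ 2)⁻¹) :
    ∃ B : ℝ, 0 < B ∧ ∀ τ : ℕ, 1 ≤ τ → alphaMixing μ V τ ≤ B / (τ : ℝ) ^ 2 := by
  obtain ⟨B, hB, hle⟩ := Asymptotics.bound_of_isBigO_nat_atTop hrate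
  refine ⟨B, hB, fun τ hτ => (le_abs_self _).trans ((hle (by positivity)).trans_eq ?_)⟩
  rw [Real.norm_of_nonneg (by positivity), div_eq_mul_inv]

variable [IsProbabilityMeasure μ]

theorem abs_measureReal_inter_sub_mul_le_one (A B : Set Ω) :
    |μ.real (A ∩ B) - μ.real A * μ.real B| ≤ 1 := by
  have hprod : μ.real A * μ.real B ≤ 1 :=
    mul_le_one₀ measureReal_le_one measureReal_nonneg measureReal_le_one
  have hprod' : 0 ≤ μ.real A * μ.real B := mul_nonneg measureReal_nonneg measureReal_nonneg
  have hinter : μ.real (A ∩ B) ≤ 1 := measureReal_le_one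
  have hinter' : 0 ≤ μ.real (A ∩ B) := measureReal_nonneg
  rw [abs_le]
  constructor <;> linarith

theorem le_alphaMixing {k τ : ℕ} {A B : Set Ω} (hA : MeasurableSet[past V k] A)
    (hB : MeasurableSet[future V (k + τ)] B) :
    |μ.real (A ∩ B) - μ.real A * μ.real B| ≤ alphaMixing μ V τ := by
  refine le_csSup ⟨1, ?_⟩ ⟨k, A, B, hA, hB, rfl⟩
  rintro _ ⟨_, A, B, _, _, rfl⟩
  exact abs_measureReal_inter_sub_mul_le_one A B

theorem abs_covariance_le_alphaMixing (hV : ∀ i, Measurable (V i)) {f g : S → ℝ}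
    (hf : Measurable f) (hg : Measurable g) {C C' : ℝ} (hfC : ∀ z, |f z| ≤ C)
    (hgC : ∀ z, |g z| ≤ C') (i τ : ℕ) :
    |cov[fun ω => f (V i ω), fun ω => g (V (i + τ) ω); μ]| ≤ 4 * C * C' * alphaMixing μ V τ := by
  have hpast : MeasurableSpace.comap (V i) inferInstance ≤ past V i :=
    le_iSup₂_of_le i le_rfl le_rfl
  have hfuture : MeasurableSpace.comap (V (i + τ)) inferInstance ≤ future V (i + τ) :=
    le_iSup₂_of_le (i + τ) le_rfl le_rfl
  exact abs_covariance_le_of_mixing (iSup₂_le fun j _ => (hV j).comap_le)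
    (iSup₂_le fun j _ => (hV j).comap_le)
    ((hf.comp (comap_measurable (V i))).mono hpast le_rfl).stronglyMeasurable (fun _ => hfC _)
    ((hg.comp (comap_measurable (V (i + τ)))).mono hfuture le_rfl).stronglyMeasurable
    (fun _ => hgC _) fun _ _ hA hB => le_alphaMixing hA hB

end Mixing

/-- The two bounds balance at lags of order `1 / a`. -/
theorem sum_Ico_le_of_le_sq_of_le_div_sq {c : ℕ → ℝ} {a A b : ℝ} (ha : 0 < a) (hA : 0 ≤ A)
    (hb : 0 ≤ b) (hconst : ∀ l, 1 ≤ l → c l ≤ A * a ^ 2)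
    (hdecay : ∀ l : ℕ, 1 ≤ l → c l ≤ b / (l : ℝ) ^ 2) (n : ℕ) :
    ∑ l ∈ Finset.Ico 1 n, c l ≤ (A * (1 + a) + 2 * b) * a := by
  set J := ⌈1 / a⌉₊
  have hJ_ge : 1 / a ≤ J := Nat.le_ceil _
  have hJ_lt : (J : ℝ) < 1 / a + 1 := Nat.ceil_lt_add_one (by positivity)
  have hhead : ∑ l ∈ Finset.Ico 1 n with l ≤ J, c l ≤ A * (1 + a) * a := by
    calc ∑ l ∈ Finset.Ico 1 n with l ≤ J, c l ≤ ∑ l ∈ Finset.Ico 1 n with l ≤ J, A * a ^ 2 :=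
          Finset.sum_le_sum fun l hl =>
            hconst l (Finset.mem_Ico.mp (Finset.mem_filter.mp hl).1).1
      _ ≤ ∑ l ∈ Finset.Icc 1 J, A * a ^ 2 := by
          refine Finset.sum_le_sum_of_subset_of_nonneg (fun l hl => ?_) fun _ _ _ => by positivity
          simp only [Finset.mem_filter, Finset.mem_Ico, Finset.mem_Icc] at hl ⊢
          omega
      _ = A * (J * a) * a := by simp only [Finset.sum_const, Nat.card_Icc, nsmul_eq_mul,
          add_tsub_cancel_right]; ring
      _ ≤ A * (1 + a) * a := by
          gcongr
          calc (J : ℝ) * a ≤ (1 / a + 1) * a := by gcongr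
            _ = 1 + a := by field_simp
  have htail : ∑ l ∈ Finset.Ico 1 n with ¬ l ≤ J, c l ≤ 2 * b * a := by
    calc ∑ l ∈ Finset.Ico 1 n with ¬ l ≤ J, c l
        ≤ ∑ l ∈ Finset.Ico 1 n with ¬ l ≤ J, b * ((l : ℝ) ^ 2)⁻¹ :=
          Finset.sum_le_sum fun l hl =>
            (hdecay l (Finset.mem_Ico.mp (Finset.mem_filter.mp hl).1).1).trans_eq
              (div_eq_mul_inv _ _)
      _ ≤ ∑ l ∈ Finset.Ioo J n, b * ((l : ℝ) ^ 2)⁻¹ := by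
          refine Finset.sum_le_sum_of_subset_of_nonneg (fun l hl => ?_) fun _ _ _ => by positivity
          simp only [Finset.mem_filter, Finset.mem_Ico, Finset.mem_Ioo] at hl ⊢
          omega
      _ ≤ b * (2 / (J + 1)) := by
          rw [← Finset.mul_sum]
          exact mul_le_mul_of_nonneg_left (sum_Ioo_inv_sq_le J n) hb
      _ ≤ b * (2 * a) := by
          gcongr
          rw [div_le_iff₀ ha] at hJ_ge
          rw [div_le_iff₀ (by positivity)]
          nlinarith
      _ = 2 * b * a := by ring
  rw [← Finset.sum_filter_add_sum_filter_not _ (· ≤ J)]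
  linarith

theorem sum_sum_le_of_lag_bound {F : ℕ → ℕ → ℝ} {c : ℕ → ℝ} (hc : ∀ l, 0 ≤ c l)
    (hsymm : ∀ i j, F i j = F j i) (hF : ∀ i l, F i (i + l) ≤ c l) (n : ℕ) :
    ∑ i ∈ Finset.range n, ∑ j ∈ Finset.range n, F i j ≤
      n * (2 * ∑ l ∈ Finset.range n, c l) := by
  have hsub : ∀ k ≤ n, ∑ l ∈ Finset.range k, c l ≤ ∑ l ∈ Finset.range n, c l := fun k hk =>
    Finset.sum_le_sum_of_subset_of_nonneg (Finset.range_subset_range.mpr hk) fun _ _ _ => hc _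
  have hbefore : ∀ i < n, ∑ j ∈ Finset.range i, F i j ≤ ∑ l ∈ Finset.range n, c l := by
    intro i hi
    rw [← Finset.sum_range_reflect]
    calc ∑ j ∈ Finset.range i, F i (i - 1 - j) ≤ ∑ j ∈ Finset.range i, c (j + 1) := by
          refine Finset.sum_le_sum fun j hj => ?_
          have hlag := hF (i - 1 - j) (j + 1)
          have hji := Finset.mem_range.mp hj
          rwa [show i - 1 - j + (j + 1) = i by omega, hsymm] at hlag
      _ ≤ ∑ j ∈ Finset.range i, c (j + 1) + c 0 := le_add_of_nonneg_right (hc 0)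
      _ = ∑ j ∈ Finset.range (i + 1), c j := (Finset.sum_range_succ' _ _).symm
      _ ≤ _ := hsub _ hi
  have hafter : ∀ i, ∑ j ∈ Finset.Ico i n, F i j ≤ ∑ l ∈ Finset.range n, c l := by
    intro i
    rw [Finset.sum_Ico_eq_sum_range]
    exact (Finset.sum_le_sum fun l _ => hF i l).trans (hsub _ (Nat.sub_le n i))
  calc _ ≤ ∑ i ∈ Finset.range n, 2 * ∑ l ∈ Finset.range n, c l := by
        refine Finset.sum_le_sum fun i hi => ?_
        have hin := Finset.mem_range.mp hi
        rw [← Finset.sum_range_add_sum_Ico _ hin.le, two_mul]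
        exact add_le_add (hbefore i hin) (hafter i)
    _ = _ := by simp only [Finset.sum_const, Finset.card_range, nsmul_eq_mul]

section Variance

variable {Ω S : Type*} {mΩ : MeasurableSpace Ω} [MeasurableSpace S] {μ : Measure Ω}
  [IsProbabilityMeasure μ] {V : ℕ → Ω → S}

theorem sum_abs_covariance_le (hV : ∀ i, Measurable (V i)) {B : ℝ}
    (hB0 : 0 ≤ B) (hB : ∀ τ : ℕ, 1 ≤ τ → alphaMixing μ V τ ≤ B / (τ : ℝ) ^ 2)
    {f : S → ℝ} (hf : Measurable f) {C : ℝ} (hfC : ∀ z, |f z| ≤ C) {D : Set S}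
    (hfD : ∀ z, z ∉ D → f z = 0) {A a : ℝ} (hA : 0 ≤ A) (ha : 0 < a) (ha1 : a ≤ 1)
    (hD : ∀ i, μ.real (V i ⁻¹' D) ≤ A * a)
    (hDD : ∀ l : ℕ, 1 ≤ l → μ.real (V 0 ⁻¹' D ∩ V l ⁻¹' D) ≤ A * a ^ 2) (n : ℕ) :
    ∑ l ∈ Finset.range n, |cov[fun ω => f (V 0 ω), fun ω => f (V l ω); μ]| ≤
      (3 * C ^ 2 * (A + A ^ 2) + 8 * C ^ 2 * B) * a := by
  set c : ℕ → ℝ := fun l => |cov[fun ω => f (V 0 ω), fun ω => f (V l ω); μ]|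
  have hloc : ∀ l, c l ≤ C ^ 2 * (μ.real (V 0 ⁻¹' D ∩ V l ⁻¹' D) + (A * a) * (A * a)) :=
    fun l => (abs_covariance_le_of_eq_zero_off (hf.comp (hV 0)).aestronglyMeasurable
      (hf.comp (hV l)).aestronglyMeasurable (fun _ => hfC _) (fun _ => hfC _)
      (fun ω hω => hfD (V 0 ω) hω) fun ω hω => hfD (V l ω) hω).trans <|
        mul_le_mul_of_nonneg_left (add_le_add le_rfl
          (mul_le_mul (hD 0) (hD l) measureReal_nonneg (by positivity))) (sq_nonneg C)
  have hzero : c 0 ≤ C ^ 2 * (A + A ^ 2) * a := by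
    calc c 0 ≤ C ^ 2 * (A * a + (A * a) * (A * a)) := (hloc 0).trans <| by
          rw [Set.inter_self]; gcongr; apply hD
      _ = C ^ 2 * (A + A ^ 2 * a) * a := by ring
      _ ≤ C ^ 2 * (A + A ^ 2) * a := by
          gcongr
          exact mul_le_of_le_one_right (by positivity) ha1
  have hconst : ∀ l, 1 ≤ l → c l ≤ C ^ 2 * (A + A ^ 2) * a ^ 2 := fun l hl =>
    calc c l ≤ C ^ 2 * (A * a ^ 2 + (A * a) * (A * a)) :=
          (hloc l).trans (by gcongr; exact hDD l hl)
      _ = C ^ 2 * (A + A ^ 2) * a ^ 2 := by ring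
  have hdecay : ∀ l : ℕ, 1 ≤ l → c l ≤ 4 * C ^ 2 * B / (l : ℝ) ^ 2 := fun l hl =>
    calc c l ≤ 4 * C * C * alphaMixing μ V l := by
          simpa only [zero_add] using abs_covariance_le_alphaMixing hV hf hf hfC hfC 0 l
      _ = 4 * C ^ 2 * alphaMixing μ V l := by ring
      _ ≤ 4 * C ^ 2 * (B / (l : ℝ) ^ 2) := by gcongr; exact hB l hl
      _ = _ := by ring
  calc ∑ l ∈ Finset.range n, c l ≤ c 0 + ∑ l ∈ Finset.Ico 1 n, c l := by
        rcases Nat.eq_zero_or_pos n with rfl | hn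
        · simp [c]
        · rw [Finset.range_eq_Ico, Finset.sum_eq_sum_Ico_succ_bot hn]
    _ ≤ C ^ 2 * (A + A ^ 2) * a + (C ^ 2 * (A + A ^ 2) * (1 + a) + 2 * (4 * C ^ 2 * B)) * a :=
        add_le_add hzero (sum_Ico_le_of_le_sq_of_le_div_sq ha (by positivity) (by positivity)
          hconst hdecay n)
    _ ≤ C ^ 2 * (A + A ^ 2) * a + (C ^ 2 * (A + A ^ 2) * (1 + 1) + 2 * (4 * C ^ 2 * B)) * a := by
        gcongr
    _ = _ := by ring

theorem variance_sum_le (hs : IsStationary μ V) (hV : ∀ i, Measurable (V i)) {B : ℝ}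
    (hB0 : 0 ≤ B) (hB : ∀ τ : ℕ, 1 ≤ τ → alphaMixing μ V τ ≤ B / (τ : ℝ) ^ 2)
    {f : S → ℝ} (hf : Measurable f) {C : ℝ} (hfC : ∀ z, |f z| ≤ C) {D : Set S}
    (hfD : ∀ z, z ∉ D → f z = 0) {A a : ℝ} (hA : 0 ≤ A) (ha : 0 < a) (ha1 : a ≤ 1)
    (hD : ∀ i, μ.real (V i ⁻¹' D) ≤ A * a)
    (hDD : ∀ l : ℕ, 1 ≤ l → μ.real (V 0 ⁻¹' D ∩ V l ⁻¹' D) ≤ A * a ^ 2) (n : ℕ) :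
    Var[fun ω => ∑ i ∈ Finset.range n, f (V i ω); μ] ≤
      (6 * C ^ 2 * (A + A ^ 2) + 16 * C ^ 2 * B) * (n * a) := by
  have hLp : ∀ i, MemLp (fun ω => f (V i ω)) 2 μ := fun i =>
    MemLp.of_bound (hf.comp (hV i)).aestronglyMeasurable C (Eventually.of_forall fun _ => hfC _)
  calc Var[fun ω => ∑ i ∈ Finset.range n, f (V i ω); μ]
      = ∑ i ∈ Finset.range n, ∑ j ∈ Finset.range n,
          cov[fun ω => f (V i ω), fun ω => f (V j ω); μ] := variance_fun_sum' fun i _ => hLp i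
    _ ≤ n * (2 * ∑ l ∈ Finset.range n, |cov[fun ω => f (V 0 ω), fun ω => f (V l ω); μ]|) :=
        sum_sum_le_of_lag_bound (fun l => abs_nonneg _) (fun i j => covariance_comm _ _)
          (fun i l => (hs.covariance_eq hV hf i l).trans_le (le_abs_self _)) n
    _ ≤ n * (2 * ((3 * C ^ 2 * (A + A ^ 2) + 8 * C ^ 2 * B) * a)) := by
        gcongr
        exact sum_abs_covariance_le hV hB0 hB hf hfC hfD hA ha ha1 hD hDD n
    _ = _ := by ring

end Variance

section Density

variable {Ω S : Type*} [MeasurableSpace Ω] {μ : Measure Ω} [MeasureSpace S] {Z : Ω → S} {f : S → ℝ}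

theorem HasDensity.measureReal_preimage_le (hf : HasDensity μ Z f) (hZ : Measurable Z) {D : Set S}
    (hD : MeasurableSet D) (hvol : volume D ≠ ⊤) {c : ℝ} (hc : 0 ≤ c) (hfc : ∀ z ∈ D, f z ≤ c) :
    μ.real (Z ⁻¹' D) ≤ c * volume.real D := by
  have hle : μ (Z ⁻¹' D) ≤ ENNReal.ofReal c * volume D := by
    rw [← Measure.map_apply hZ hD, hf.2.2, withDensity_apply _ hD, ← setLIntegral_const]
    exact setLIntegral_mono measurable_const fun z hz => ENNReal.ofReal_le_ofReal (hfc z hz)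
  have hreal := ENNReal.toReal_mono (ENNReal.mul_ne_top ENNReal.ofReal_ne_top hvol) hle
  rwa [ENNReal.toReal_mul, ENNReal.toReal_ofReal hc] at hreal

theorem HasDensity.integral_comp (hf : HasDensity μ Z f) (hZ : Measurable Z) {φ : S → ℝ}
    (hφ : Measurable φ) : ∫ ω, φ (Z ω) ∂μ = ∫ z, f z * φ z := by
  rw [← integral_map hZ.aemeasurable hφ.aestronglyMeasurable, hf.2.2,
    integral_withDensity_eq_integral_toReal_smul hf.1.ennreal_ofReal
      (Eventually.of_forall fun _ => ENNReal.ofReal_lt_top)]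
  simp only [ENNReal.toReal_ofReal (hf.2.1 _), smul_eq_mul]

end Density

section LocalRegularity

variable {Ω : Type*} [MeasurableSpace Ω] {μ : Measure Ω} {w : ℕ}

theorem add_smul_zoom {h : ℝ} (hh : h ≠ 0) (x z : E w) : x + h • zoom h x z = z := by
  rw [zoom, smul_inv_smul₀ hh, add_sub_cancel]

theorem norm_zoom {h : ℝ} (hh : 0 < h) (x z : E w) : ‖zoom h x z‖ = ‖z - x‖ / h := by
  rw [zoom, norm_smul, norm_inv, Real.norm_of_nonneg hh.le, inv_mul_eq_div]

theorem continuous_zoom (h : ℝ) (x : E w) : Continuous (zoom h x) := by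
  unfold zoom
  fun_prop

theorem integral_comp_zoom {h : ℝ} (hh : 0 ≤ h) (x : E w) (ψ : E w → ℝ) :
    ∫ z, ψ (zoom h x z) = h ^ w * ∫ u, ψ u := by
  unfold zoom
  rw [integral_sub_right_eq_self (fun z => ψ (h⁻¹ • z)) x,
    Measure.integral_comp_inv_smul_of_nonneg _ _ hh, finrank_euclideanSpace_fin, smul_eq_mul]

theorem HasDensity.integral_comp_zoom {Z : Ω → E w} {g : E w → ℝ} (hg : HasDensity μ Z g)
    (hZ : Measurable Z) {h : ℝ} (hh : 0 < h) (x : E w) {φ : E w → ℝ} (hφ : Measurable φ) :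
    (h ^ w)⁻¹ * ∫ ω, φ (zoom h x (Z ω)) ∂μ = ∫ u, g (x + h • u) * φ u := by
  have hchange := RNW.integral_comp_zoom hh.le x fun u => g (x + h • u) * φ u
  simp only [add_smul_zoom hh.ne'] at hchange
  rw [hg.integral_comp (φ := fun z => φ (zoom h x z)) hZ
    (hφ.comp (continuous_zoom h x).measurable), hchange, inv_mul_cancel_left₀ (pow_pos hh w).ne']

theorem HasDensity.tendsto_mean_zoom {Z : Ω → E w} {g : E w → ℝ} (hg : HasDensity μ Z g)
    (hZ : Measurable Z) {x : E w} (hgx : ContinuousAt g x) {h : ℕ → ℝ} (hpos : ∀ n, 0 < h n)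
    (hzero : Tendsto h atTop (𝓝 0)) {φ : E w → ℝ} (hφ : Continuous φ)
    (hφs : HasCompactSupport φ) :
    Tendsto (fun n => (h n ^ w)⁻¹ * ∫ ω, φ (zoom (h n) x (Z ω)) ∂μ) atTop
      (𝓝 (g x * ∫ u, φ u)) := by
  obtain ⟨R, -, hφR⟩ := hφs.exists_pos_le_norm
  obtain ⟨ρ, hρ, hgρ⟩ := Metric.continuousAt_iff.mp hgx 1 one_pos
  have hpoint : ∀ u, Tendsto (fun n => x + h n • u) atTop (𝓝 x) := fun u => by
    simpa using (hzero.smul_const u).const_add x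
  simp_rw [fun n => hg.integral_comp_zoom hZ (hpos n) x hφ.measurable, ← integral_const_mul]
  refine tendsto_integral_filter_of_dominated_convergence (fun u => (|g x| + 1) * |φ u|)
    (Eventually.of_forall fun n => ?_) ?_
    ((hφ.integrable_of_hasCompactSupport hφs).abs.const_mul _)
    (Eventually.of_forall fun u => (hgx.tendsto.comp (hpoint u)).mul_const (φ u))
  · exact ((hg.1.comp (by fun_prop)).mul hφ.measurable).aestronglyMeasurable
  · have hsmall : ∀ᶠ n in atTop, h n * R < ρ :=
      (by simpa using hzero.mul_const R : Tendsto (fun n => h n * R) atTop (𝓝 0)).eventually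
        (gt_mem_nhds hρ)
    filter_upwards [hsmall] with n hn
    refine Eventually.of_forall fun u => ?_
    rw [Real.norm_eq_abs, abs_mul]
    rcases le_or_gt R ‖u‖ with hu | hu
    · simp [hφR u hu]
    · have hdist : dist (x + h n • u) x < ρ := by
        rw [dist_self_add_left, norm_smul, Real.norm_of_nonneg (hpos n).le]
        exact (mul_le_mul_of_nonneg_left hu.le (hpos n).le).trans_lt hn
      have hclose := hgρ hdist
      rw [Real.dist_eq] at hclose
      gcongr
      linarith [abs_sub_abs_le_abs_sub (g (x + h n • u)) (g x)]

theorem exists_measureReal_closedBall_le {X : ℕ → Ω → E w} (hX : ∀ i, Measurable (X i))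
    {g : E w → ℝ} (hg : ∀ i, HasDensity μ (X i) g) {G : ℕ → E w × E w → ℝ}
    (hG : ∀ i, 1 ≤ i → HasDensity μ (fun ω => (X 0 ω, X i ω)) (G i)) {x : E w}
    (hgx : ContinuousAt g x) {M : ℝ} (hM : 0 ≤ M)
    (hGM : ∀ i : ℕ, 1 ≤ i → ∀ u v : E w, |G i (u, v) - g u * g v| ≤ M) :
    ∃ A, 0 ≤ A ∧ ∃ ρ > 0, ∀ r, 0 ≤ r → r < ρ →
      (∀ i, μ.real (X i ⁻¹' Metric.closedBall x r) ≤ A * r ^ w) ∧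
      ∀ l, 1 ≤ l → μ.real (X 0 ⁻¹' Metric.closedBall x r ∩ X l ⁻¹' Metric.closedBall x r) ≤
        A * (r ^ w) ^ 2 := by
  set c := |g x| + 1
  set v := volume.real (Metric.ball (0 : E w) 1)
  have hc : 0 ≤ c := by positivity
  obtain ⟨ρ, hρ, hgρ⟩ := Metric.continuousAt_iff.mp hgx 1 one_pos
  refine ⟨c * v + (c ^ 2 + M) * v ^ 2, by positivity, ρ, hρ, fun r hr hrρ => ?_⟩
  set D := Metric.closedBall x r
  have hD : MeasurableSet D := Metric.isClosed_closedBall.measurableSet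
  have hDtop : volume D ≠ ⊤ := measure_closedBall_lt_top.ne
  have hDvol : volume.real D = r ^ w * v := by
    rw [Measure.addHaar_real_closedBall _ _ hr, finrank_euclideanSpace_fin]
  have hgD : ∀ z ∈ D, g z ≤ c := fun z hz => by
    have hclose := hgρ (lt_of_le_of_lt hz hrρ)
    rw [Real.dist_eq] at hclose
    linarith [(abs_lt.mp hclose).2, le_abs_self (g x)]
  constructor
  · intro i
    refine ((hg i).measureReal_preimage_le (hX i) hD hDtop hc hgD).trans ?_
    rw [hDvol, mul_left_comm, mul_comm]
    gcongr
    exact le_add_of_nonneg_right (by positivity)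
  · intro l hl
    have hGD : ∀ z ∈ D ×ˢ D, G l z ≤ c ^ 2 + M := fun z hz => by
      have hprod := mul_le_mul (hgD _ hz.1) (hgD _ hz.2) ((hg 0).2.1 z.2) hc
      have hdiff := (abs_le.mp (hGM l hl z.1 z.2)).2
      linarith
    have hbound := (hG l hl).measureReal_preimage_le ((hX 0).prodMk (hX l)) (hD.prod hD)
      (by rw [Measure.volume_eq_prod, Measure.prod_prod]; exact ENNReal.mul_ne_top hDtop hDtop)
      (by positivity) hGD
    rw [Set.mk_preimage_prod] at hbound
    refine hbound.trans ?_
    rw [Measure.volume_eq_prod, measureReal_prod_prod, hDvol]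
    calc (c ^ 2 + M) * (r ^ w * v * (r ^ w * v)) = (c ^ 2 + M) * v ^ 2 * (r ^ w) ^ 2 := by ring
      _ ≤ _ := by
        gcongr
        exact le_add_of_nonneg_left (by positivity)

/-- What the localized averages use of the process `(X i, Y i)`: near `x`, at scale `h n`, the
predictors have mean intensity `γ`, and sums of bounded functions supported at that scale have
the variance of the independent case, up to a constant. -/
structure IsLocallyRegular (μ : Measure Ω) (X : ℕ → Ω → E w) (Y : ℕ → Ω → ℝ) (x : E w)
    (h : ℕ → ℝ) (γ : ℝ) : Prop where
  measurable_fst : ∀ i, Measurable (X i)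
  measurable_snd : ∀ i, Measurable (Y i)
  identDistrib : ∀ i, IdentDistrib (fun ω => (X i ω, Y i ω)) (fun ω => (X 0 ω, Y 0 ω)) μ μ
  bandwidth_pos : ∀ n, 0 < h n
  tendsto_bandwidth : Tendsto h atTop (𝓝 0)
  tendsto_mul_pow : Tendsto (fun n : ℕ => (n : ℝ) * h n ^ w) atTop atTop
  intensity_pos : 0 < γ
  tendsto_mean : ∀ φ : E w → ℝ, Continuous φ → HasCompactSupport φ →
    Tendsto (fun n => (h n ^ w)⁻¹ * ∫ ω, φ (zoom (h n) x (X 0 ω)) ∂μ) atTop (𝓝 (γ * ∫ u, φ u))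
  variance_le : ∀ R C : ℝ, 0 < R → ∃ A, 0 ≤ A ∧ ∀ᶠ n in atTop, ∀ f : E w × ℝ → ℝ, Measurable f →
    (∀ z, |f z| ≤ C) → (∀ z, R < ‖zoom (h n) x z.1‖ → f z = 0) →
      Var[fun ω => ∑ i : Fin n, f (X i ω, Y i ω); μ] ≤ A * (n * h n ^ w)

theorem isLocallyRegular_of_isStationary [IsProbabilityMeasure μ] {X : ℕ → Ω → E w}
    {Y : ℕ → Ω → ℝ} (hX : ∀ i, Measurable (X i)) (hY : ∀ i, Measurable (Y i))
    (hstat : IsStationary μ fun i ω => (X i ω, Y i ω))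
    (hrate : alphaMixing μ (fun i ω => (X i ω, Y i ω)) =O[atTop] fun τ : ℕ => ((τ : ℝ) ^ 2)⁻¹)
    {g : E w → ℝ} (hg : HasDensity μ (X 0) g) {G : ℕ → E w × E w → ℝ}
    (hG : ∀ i, 1 ≤ i → HasDensity μ (fun ω => (X 0 ω, X i ω)) (G i)) {x : E w}
    (hgpos : 0 < g x) (hgx : ContinuousAt g x)
    (hGM : ∃ M : ℝ, 0 < M ∧ ∀ i : ℕ, 1 ≤ i → ∀ u v : E w, |G i (u, v) - g u * g v| ≤ M)
    {h : ℕ → ℝ} (hpos : ∀ n, 0 < h n) (hzero : Tendsto h atTop (𝓝 0))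
    (htop : Tendsto (fun n : ℕ => (n : ℝ) * h n ^ w) atTop atTop) :
    IsLocallyRegular μ X Y x h (g x) := by
  have hV : ∀ i, Measurable fun ω => (X i ω, Y i ω) := fun i => (hX i).prodMk (hY i)
  have hident := hstat.identDistrib hV
  refine ⟨hX, hY, hident, hpos, hzero, htop, hgpos,
    fun φ hφ hφs => hg.tendsto_mean_zoom (hX 0) hgx hpos hzero hφ hφs, fun R C hR => ?_⟩
  obtain ⟨M, hM, hGM⟩ := hGM
  obtain ⟨B, hB, hαB⟩ := exists_alphaMixing_le hrate
  have hgi : ∀ i, HasDensity μ (X i) g := fun i =>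
    ⟨hg.1, hg.2.1, ((hident i).comp measurable_fst).map_eq.trans hg.2.2⟩
  obtain ⟨A, hA, ρ, hρ, hball⟩ := exists_measureReal_closedBall_le hX hgi hG hgx hM.le hGM
  refine ⟨(6 * C ^ 2 * (A + A ^ 2) + 16 * C ^ 2 * B) * R ^ w, by positivity, ?_⟩
  have hlim : Tendsto (fun n => R * h n) atTop (𝓝 0) := by simpa using hzero.const_mul R
  filter_upwards [hlim.eventually (gt_mem_nhds hρ), hlim.eventually (gt_mem_nhds one_pos)]
    with n hnρ hn1 f hf hfC hfR
  have hr : 0 < R * h n := mul_pos hR (hpos n)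
  have hoff : ∀ z, z ∉ Prod.fst ⁻¹' Metric.closedBall x (R * h n) → f z = 0 := fun z hz => by
    refine hfR z ?_
    rw [norm_zoom (hpos n), lt_div_iff₀ (hpos n)]
    simpa only [Set.mem_preimage, mem_closedBall_iff_norm, not_le] using hz
  have hvar := variance_sum_le hstat hV hB.le hαB hf hfC hoff hA (pow_pos hr w)
    (pow_le_one₀ hr.le hn1.le) (hball _ hr.le hnρ).1 (hball _ hr.le hnρ).2 n
  simp only [Finset.sum_range] at hvar
  exact hvar.trans_eq (by ring)

end LocalRegularity

section InProbability

variable {Ω : Type*} [MeasurableSpace Ω] {μ : Measure Ω}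

/-- The probability of `P n` tends to one, stated through the complement so that `P n` need not be
measurable. -/
def WithHighProb (μ : Measure Ω) (P : ℕ → Ω → Prop) : Prop :=
  Tendsto (fun n => μ {ω | ¬ P n ω}) atTop (𝓝 0)

theorem WithHighProb.mono {P Q : ℕ → Ω → Prop} (hP : WithHighProb μ P)
    (hPQ : ∀ᶠ n in atTop, ∀ ω, P n ω → Q n ω) : WithHighProb μ Q :=
  tendsto_of_tendsto_of_tendsto_of_le_of_le' tendsto_const_nhds hP
    (Eventually.of_forall fun _ => bot_le)
    (hPQ.mono fun _ hn => measure_mono fun ω hω hPω => hω (hn ω hPω))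

theorem WithHighProb.of_eventually {P : ℕ → Ω → Prop} (hP : ∀ᶠ n in atTop, ∀ ω, P n ω) :
    WithHighProb μ P :=
  tendsto_const_nhds.congr' (hP.mono fun n hn => by simp [hn])

theorem WithHighProb.forall {ι : Type*} [Finite ι] {P : ι → ℕ → Ω → Prop}
    (hP : ∀ i, WithHighProb μ (P i)) : WithHighProb μ fun n ω => ∀ i, P i n ω := by
  have := Fintype.ofFinite ι
  have hsum := tendsto_finsetSum Finset.univ fun i _ => hP i
  rw [Finset.sum_const_zero] at hsum
  refine tendsto_of_tendsto_of_tendsto_of_le_of_le tendsto_const_nhds hsum (fun _ => bot_le)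
    fun _ => ?_
  simp only [not_forall, Set.ofPred_exists]
  exact measure_iUnion_fintype_le μ _

theorem WithHighProb.and {P Q : ℕ → Ω → Prop} (hP : WithHighProb μ P) (hQ : WithHighProb μ Q) :
    WithHighProb μ fun n ω => P n ω ∧ Q n ω := by
  have hboth := WithHighProb.forall (P := fun b : Bool => cond b P Q) (Bool.rec hQ hP)
  exact hboth.mono (Eventually.of_forall fun n ω hω => ⟨hω true, hω false⟩)

theorem isLittleOInProb_iff_withHighProb {R : ℕ → Ω → ℝ} {a : ℕ → ℝ} :
    IsLittleOInProb μ R a ↔ ∀ ε, 0 < ε → WithHighProb μ fun n ω => |R n ω| ≤ ε * a n := by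
  simp only [IsLittleOInProb, WithHighProb, not_le]

theorem IsBigOInProb.abs {R : ℕ → Ω → ℝ} {a : ℕ → ℝ} (hR : IsBigOInProb μ R a) :
    IsBigOInProb μ (fun n ω => |R n ω|) a := by
  simpa only [IsBigOInProb, abs_abs] using hR

theorem IsBigOInProb.add {R Q : ℕ → Ω → ℝ} {a : ℕ → ℝ} (hR : IsBigOInProb μ R a)
    (hQ : IsBigOInProb μ Q a) : IsBigOInProb μ (fun n ω => R n ω + Q n ω) a := by
  intro ε hε
  obtain ⟨M, hM, hRM⟩ := hR (ε / 2) (half_pos hε)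
  obtain ⟨L, hL, hQL⟩ := hQ (ε / 2) (half_pos hε)
  refine ⟨M + L, add_pos hM hL, ?_⟩
  filter_upwards [hRM, hQL] with n hRn hQn
  calc μ {ω | (M + L) * a n < |R n ω + Q n ω|}
      ≤ μ ({ω | M * a n < |R n ω|} ∪ {ω | L * a n < |Q n ω|}) := by
        refine measure_mono fun ω hω => ?_
        simp only [Set.mem_union, Set.mem_ofPred_eq] at hω ⊢
        by_contra! hle
        linarith [abs_add_le (R n ω) (Q n ω)]
    _ ≤ ENNReal.ofReal (ε / 2) + ENNReal.ofReal (ε / 2) :=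
        (measure_union_le _ _).trans (add_le_add hRn hQn)
    _ = ENNReal.ofReal ε := by
        rw [← ENNReal.ofReal_add (half_pos hε).le (half_pos hε).le, add_halves]

theorem isBigOInProb_zero {a : ℕ → ℝ} (ha : ∀ n, 0 ≤ a n) :
    IsBigOInProb μ (fun _ _ => 0) a :=
  fun ε _ => ⟨1, one_pos, Eventually.of_forall fun n => by simp [(ha n).not_gt]⟩

theorem IsBigOInProb.sum {ι : Type*} {R : ι → ℕ → Ω → ℝ} {a : ℕ → ℝ} (ha : ∀ n, 0 ≤ a n)
    (hR : ∀ i, IsBigOInProb μ (R i) a) (s : Finset ι) :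
    IsBigOInProb μ (fun n ω => ∑ i ∈ s, R i n ω) a := by
  classical
  induction s using Finset.induction_on with
  | empty => simpa only [Finset.sum_empty] using isBigOInProb_zero ha
  | insert i s hi ih => simpa only [Finset.sum_insert hi] using (hR i).add ih

theorem IsBigOInProb.of_abs_le_mul {R Q : ℕ → Ω → ℝ} {a : ℕ → ℝ} (ha : ∀ n, 0 ≤ a n)
    (hQ : IsBigOInProb μ Q a) {c : ℝ} (hc : 0 ≤ c)
    (hle : WithHighProb μ fun n ω => |R n ω| ≤ c * |Q n ω|) : IsBigOInProb μ R a := by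
  intro ε hε
  obtain ⟨M, hM, hQM⟩ := hQ (ε / 2) (half_pos hε)
  refine ⟨c * M + 1, by positivity, ?_⟩
  filter_upwards [hQM, ENNReal.tendsto_nhds_zero.mp hle _ (ENNReal.ofReal_pos.mpr (half_pos hε))]
    with n hQn hlen
  calc μ {ω | (c * M + 1) * a n < |R n ω|}
      ≤ μ ({ω | ¬ |R n ω| ≤ c * |Q n ω|} ∪ {ω | M * a n < |Q n ω|}) := by
        refine measure_mono fun ω hω => ?_
        simp only [Set.mem_union, Set.mem_ofPred_eq] at hω ⊢
        by_contra! hcon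
        nlinarith [hcon.1, mul_le_mul_of_nonneg_left hcon.2 hc, ha n]
    _ ≤ ENNReal.ofReal (ε / 2) + ENNReal.ofReal (ε / 2) :=
        (measure_union_le _ _).trans (add_le_add hlen hQn)
    _ = ENNReal.ofReal ε := by
        rw [← ENNReal.ofReal_add (half_pos hε).le (half_pos hε).le, add_halves]

theorem IsBigOInProb.withHighProb_abs_le {R : ℕ → Ω → ℝ} {a : ℕ → ℝ} (hR : IsBigOInProb μ R a)
    (ha : Tendsto a atTop (𝓝 0)) {ε : ℝ} (hε : 0 < ε) :
    WithHighProb μ fun n ω => |R n ω| ≤ ε := by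
  refine ENNReal.tendsto_nhds_zero.mpr fun η hη => ?_
  obtain ⟨t, ht, htη⟩ : ∃ t : ℝ, 0 < t ∧ ENNReal.ofReal t ≤ η := by
    obtain ⟨t, ht, htη⟩ := ENNReal.lt_iff_exists_nnreal_btwn.mp hη
    exact ⟨t, by exact_mod_cast ht, by simpa using htη.le⟩
  obtain ⟨M, -, hRM⟩ := hR t ht
  have hsmall : ∀ᶠ n in atTop, M * a n < ε :=
    (by simpa using ha.const_mul M : Tendsto (fun n => M * a n) atTop (𝓝 0)).eventually
      (gt_mem_nhds hε)
  filter_upwards [hRM, hsmall] with n hn hlt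
  exact (measure_mono fun ω hω => hlt.trans (not_le.mp hω)).trans (hn.trans htη)

theorem isBigOInProb_sub_integral_of_variance_le [IsFiniteMeasure μ] {S : ℕ → Ω → ℝ} {a : ℕ → ℝ}
    {A : ℝ} (hA : 0 ≤ A) (ha : ∀ᶠ n in atTop, 0 < a n) (hS : ∀ᶠ n in atTop, MemLp (S n) 2 μ)
    (hvar : ∀ᶠ n in atTop, Var[S n; μ] ≤ A * a n ^ 2) :
    IsBigOInProb μ (fun n ω => S n ω - ∫ ω', S n ω' ∂μ) a := by
  intro ε hε
  refine ⟨A / ε + 1, by positivity, ?_⟩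
  filter_upwards [ha, hS, hvar] with n han hSn hvarn
  have hM : 0 < A / ε + 1 := by positivity
  refine le_trans (measure_mono (Set.ofPred_subset_ofPred.mpr fun ω => le_of_lt))
    ((meas_ge_le_variance_div_sq hSn (mul_pos hM han)).trans (ENNReal.ofReal_le_ofReal ?_))
  rw [div_le_iff₀ (by positivity), mul_pow, ← mul_assoc]
  refine hvarn.trans (mul_le_mul_of_nonneg_right ?_ (sq_nonneg _))
  calc A = ε * (A / ε) := (mul_div_cancel₀ A hε.ne').symm
    _ ≤ ε * (A / ε + 1) ^ 2 := by
        gcongr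
        nlinarith [div_nonneg hA hε.le]

end InProbability

section LocalAverage

variable {Ω : Type*} [MeasurableSpace Ω] {μ : Measure Ω} {w : ℕ} {X : ℕ → Ω → E w}
  {Y : ℕ → Ω → ℝ} {x : E w} {h : ℕ → ℝ} {γ : ℝ}

theorem IsLocallyRegular.eventually_pos (hreg : IsLocallyRegular μ X Y x h γ) :
    ∀ᶠ n : ℕ in atTop, 0 < (n : ℝ) * h n ^ w :=
  hreg.tendsto_mul_pow.eventually_gt_atTop 0

theorem IsLocallyRegular.rate_nonneg (hreg : IsLocallyRegular μ X Y x h γ) (n : ℕ) :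
    0 ≤ ((n : ℝ) * h n ^ w) ^ (-(1 / 2) : ℝ) :=
  Real.rpow_nonneg (mul_nonneg n.cast_nonneg (pow_nonneg (hreg.bandwidth_pos n).le w)) _

theorem IsLocallyRegular.integral_sum [IsFiniteMeasure μ] (hreg : IsLocallyRegular μ X Y x h γ)
    {f : E w × ℝ → ℝ} (hf : Measurable f) {C : ℝ} (hC : ∀ z, |f z| ≤ C) (n : ℕ) :
    ∫ ω, ∑ i : Fin n, f (X i ω, Y i ω) ∂μ = n * ∫ ω, f (X 0 ω, Y 0 ω) ∂μ := by
  have hmeas : ∀ i, Measurable fun ω => f (X i ω, Y i ω) := fun i =>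
    hf.comp ((hreg.measurable_fst i).prodMk (hreg.measurable_snd i))
  have hint : ∀ i : Fin n, Integrable (fun ω => f (X i ω, Y i ω)) μ := fun i =>
    Integrable.of_bound (hmeas i).aestronglyMeasurable C (Eventually.of_forall fun ω => hC _)
  rw [integral_finsetSum _ fun i _ => hint i]
  have hident : ∀ i, ∫ ω, f (X i ω, Y i ω) ∂μ = ∫ ω, f (X 0 ω, Y 0 ω) ∂μ := fun i =>
    ((hreg.identDistrib i).comp hf).integral_eq
  simp only [hident, Finset.sum_const, Finset.card_univ, Fintype.card_fin, nsmul_eq_mul]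

theorem IsLocallyRegular.isBigOInProb_centered_average [IsFiniteMeasure μ]
    (hreg : IsLocallyRegular μ X Y x h γ) {R C : ℝ} (hR : 0 < R) {f : ℕ → E w × ℝ → ℝ}
    (hf : ∀ᶠ n in atTop, Measurable (f n) ∧ (∀ z, |f n z| ≤ C) ∧
      ∀ z, R < ‖zoom (h n) x z.1‖ → f n z = 0) :
    IsBigOInProb μ (fun n ω => ((n : ℝ) * h n ^ w)⁻¹ * ∑ i : Fin n, f n (X i ω, Y i ω) -
        ((n : ℝ) * h n ^ w)⁻¹ * (n * ∫ ω', f n (X 0 ω', Y 0 ω') ∂μ))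
      (fun n => ((n : ℝ) * h n ^ w) ^ (-(1 / 2) : ℝ)) := by
  obtain ⟨A, hA, hvar⟩ := hreg.variance_le R C hR
  have hmem : ∀ᶠ n : ℕ in atTop, MemLp
      (fun ω => ((n : ℝ) * h n ^ w)⁻¹ * ∑ i : Fin n, f n (X i ω, Y i ω)) 2 μ := by
    filter_upwards [hf] with n ⟨hfm, hfC, _⟩
    have hterm : ∀ i : Fin n, MemLp (fun ω => f n (X i ω, Y i ω)) 2 μ := fun i => MemLp.of_bound
      (hfm.comp ((hreg.measurable_fst i).prodMk (hreg.measurable_snd i))).aestronglyMeasurable C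
      (Eventually.of_forall fun ω => hfC _)
    exact (memLp_finsetSum Finset.univ fun i _ => hterm i).const_mul _
  have hvar' : ∀ᶠ n : ℕ in atTop,
      Var[fun ω => ((n : ℝ) * h n ^ w)⁻¹ * ∑ i : Fin n, f n (X i ω, Y i ω); μ] ≤
        A * (((n : ℝ) * h n ^ w) ^ (-(1 / 2) : ℝ)) ^ 2 := by
    filter_upwards [hf, hvar, hreg.eventually_pos] with n hfn hvarn hN
    have hsq : (((n : ℝ) * h n ^ w) ^ (-(1 / 2) : ℝ)) ^ 2 = ((n : ℝ) * h n ^ w)⁻¹ := by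
      rw [← Real.rpow_mul_natCast hN.le, ← Real.rpow_neg_one]
      norm_num
    rw [variance_const_mul, hsq]
    refine (mul_le_mul_of_nonneg_left (hvarn (f n) hfn.1 hfn.2.1 hfn.2.2) (sq_nonneg _)).trans_eq ?_
    field_simp
  refine fun ε hε => (isBigOInProb_sub_integral_of_variance_le hA
    (hreg.eventually_pos.mono fun n hn => Real.rpow_pos_of_pos hn (-(1 / 2))) hmem hvar' ε hε).imp
    fun M hM => ⟨hM.1, ?_⟩
  filter_upwards [hM.2, hf] with n hn hfn
  rwa [integral_const_mul, hreg.integral_sum hfn.1 hfn.2.1] at hn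

theorem IsLocallyRegular.isBigOInProb_average [IsFiniteMeasure μ]
    (hreg : IsLocallyRegular μ X Y x h γ) {R C : ℝ} (hR : 0 < R) {f : ℕ → E w × ℝ → ℝ}
    (hf : ∀ᶠ n in atTop, Measurable (f n) ∧ (∀ z, |f n z| ≤ C) ∧
      ∀ z, R < ‖zoom (h n) x z.1‖ → f n z = 0)
    (hmean : ∀ᶠ n in atTop, ∫ ω, f n (X 0 ω, Y 0 ω) ∂μ = 0) :
    IsBigOInProb μ (fun n ω => ((n : ℝ) * h n ^ w)⁻¹ * ∑ i : Fin n, f n (X i ω, Y i ω))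
      (fun n => ((n : ℝ) * h n ^ w) ^ (-(1 / 2) : ℝ)) := by
  refine fun ε hε => (hreg.isBigOInProb_centered_average hR hf ε hε).imp fun M hM => ⟨hM.1, ?_⟩
  filter_upwards [hM.2, hmean] with n hn hzero
  simpa only [hzero, mul_zero, sub_zero] using hn

theorem norm_le_sum_abs (v : E w) : ‖v‖ ≤ ∑ j, |v j| := by
  conv_lhs => rw [← (EuclideanSpace.basisFun (Fin w) ℝ).sum_repr v]
  refine (norm_sum_le _ _).trans_eq (Finset.sum_congr rfl fun j _ => ?_)
  simp [norm_smul]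

theorem integral_apply_coord {A : Type*} [MeasurableSpace A] {ν : Measure A} {f : A → E w}
    (hf : Integrable f ν) (j : Fin w) : ∫ a, f a j ∂ν = (∫ a, f a ∂ν) j :=
  (EuclideanSpace.proj (𝕜 := ℝ) j).integral_comp_comm hf

theorem IsLocallyRegular.isBigOInProb_norm_average [IsFiniteMeasure μ]
    (hreg : IsLocallyRegular μ X Y x h γ) {R C : ℝ} (hR : 0 < R) {f : ℕ → E w → E w}
    (hf : ∀ᶠ n in atTop, Measurable (f n) ∧ (∀ z, ‖f n z‖ ≤ C) ∧
      ∀ z, R < ‖zoom (h n) x z‖ → f n z = 0)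
    (hmean : ∀ᶠ n in atTop, ∫ ω, f n (X 0 ω) ∂μ = 0) :
    IsBigOInProb μ (fun n ω => ((n : ℝ) * h n ^ w)⁻¹ * ‖∑ i : Fin n, f n (X i ω)‖)
      (fun n => ((n : ℝ) * h n ^ w) ^ (-(1 / 2) : ℝ)) := by
  have hcoord : ∀ j, IsBigOInProb μ
      (fun n ω => ((n : ℝ) * h n ^ w)⁻¹ * ∑ i : Fin n, f n (X i ω) j)
      (fun n => ((n : ℝ) * h n ^ w) ^ (-(1 / 2) : ℝ)) := fun j => by
    refine hreg.isBigOInProb_average (f := fun n z => f n z.1 j) (C := C) hR ?_ ?_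
    · filter_upwards [hf] with n ⟨hfm, hfC, hfR⟩
      exact ⟨by fun_prop, fun z => (PiLp.norm_apply_le (f n z.1) j).trans (hfC _), fun z hz => by
        rw [hfR z.1 hz, PiLp.zero_apply]⟩
    · filter_upwards [hf, hmean] with n ⟨hfm, hfC, _⟩ hzero
      have hint : Integrable (fun ω => f n (X 0 ω)) μ := Integrable.of_bound
        (hfm.comp (hreg.measurable_fst 0)).aestronglyMeasurable C
        (Eventually.of_forall fun ω => hfC _)
      rw [integral_apply_coord hint, hzero, PiLp.zero_apply]
  refine (IsBigOInProb.sum hreg.rate_nonneg (fun j => (hcoord j).abs) Finset.univ).of_abs_le_mul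
    hreg.rate_nonneg zero_le_one (.of_eventually ?_)
  filter_upwards [hreg.eventually_pos] with n hN ω
  simp only [abs_mul, abs_of_pos (inv_pos.mpr hN), abs_norm, one_mul, ← Finset.mul_sum]
  rw [abs_of_nonneg (Finset.sum_nonneg fun _ _ => abs_nonneg _)]
  gcongr
  simpa only [WithLp.ofLp_sum, Finset.sum_apply] using norm_le_sum_abs (∑ i : Fin n, f n (X i ω))

theorem IsLocallyRegular.withHighProb_abs_average_sub_le [IsFiniteMeasure μ]
    (hreg : IsLocallyRegular μ X Y x h γ) {φ : E w → ℝ} (hφ : Continuous φ)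
    (hφs : HasCompactSupport φ) {ε : ℝ} (hε : 0 < ε) :
    WithHighProb μ fun n ω => |((n : ℝ) * h n ^ w)⁻¹ *
      ∑ i : Fin n, φ (zoom (h n) x (X i ω)) - γ * ∫ u, φ u| ≤ ε := by
  obtain ⟨R, hR, hφR⟩ := hφs.exists_pos_le_norm
  obtain ⟨C, hC⟩ := hφs.exists_bound_of_continuous hφ
  have hdev := hreg.isBigOInProb_centered_average (f := fun n z => φ (zoom (h n) x z.1)) hR
    (Eventually.of_forall fun n => ⟨hφ.measurable.comp
      ((continuous_zoom (h n) x).measurable.comp _root_.measurable_fst), fun z => hC _,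
      fun z hz => hφR _ hz.le⟩)
  have hrate : Tendsto (fun n : ℕ => ((n : ℝ) * h n ^ w) ^ (-(1 / 2) : ℝ)) atTop (𝓝 0) :=
    (tendsto_rpow_neg_atTop (by norm_num)).comp hreg.tendsto_mul_pow
  refine (hdev.withHighProb_abs_le hrate (half_pos hε)).mono ?_
  filter_upwards [Metric.tendsto_nhds.mp (hreg.tendsto_mean φ hφ hφs) (ε / 2) (half_pos hε),
    eventually_ne_atTop 0] with n hmean hn ω hω
  rw [Real.dist_eq] at hmean
  have hcancel : ((n : ℝ) * h n ^ w)⁻¹ * (n * ∫ ω', φ (zoom (h n) x (X 0 ω')) ∂μ) =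
      (h n ^ w)⁻¹ * ∫ ω', φ (zoom (h n) x (X 0 ω')) ∂μ := by
    rw [mul_inv_rev, mul_assoc, inv_mul_cancel_left₀ (Nat.cast_ne_zero.mpr hn)]
  rw [hcancel] at hω
  exact (abs_sub_le _ _ _).trans ((add_le_add hω hmean.le).trans_eq (add_halves ε))

end LocalAverage

section Taylor

variable {V F : Type*} [NormedAddCommGroup V] [NormedSpace ℝ V] [NormedAddCommGroup F]
  [NormedSpace ℝ F] {f : V → F} {x : V}

theorem norm_taylor_two_le_of_norm_fderiv_sub_le (D : V →L[ℝ] V →L[ℝ] F) {v : V} {C : ℝ}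
    (hf : ∀ t ∈ Set.Icc (0 : ℝ) 1, DifferentiableAt ℝ f (x + t • v))
    (hD : ∀ t ∈ Set.Icc (0 : ℝ) 1, ‖fderiv ℝ f (x + t • v) - fderiv ℝ f x - D (t • v)‖ ≤ C) :
    ‖f (x + v) - f x - fderiv ℝ f x v - (1 / 2 : ℝ) • D v v‖ ≤ C * ‖v‖ := by
  set φ : ℝ → F := fun t => f (x + t • v) - t • fderiv ℝ f x v - (t ^ 2 / 2) • D v v with hφ
  have hφ' : ∀ t ∈ Set.Icc (0 : ℝ) 1, HasDerivAt φ
      ((fderiv ℝ f (x + t • v) - fderiv ℝ f x - D (t • v)) v) t := by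
    intro t ht
    have hline : HasDerivAt (fun t : ℝ => x + t • v) v t := by
      simpa using ((hasDerivAt_id t).smul_const v).const_add x
    have hlin : HasDerivAt (fun t : ℝ => t • fderiv ℝ f x v) (fderiv ℝ f x v) t := by
      simpa using (hasDerivAt_id t).smul_const (fderiv ℝ f x v)
    have hquad : HasDerivAt (fun t : ℝ => (t ^ 2 / 2) • D v v) (t • D v v) t := by
      simpa using (((hasDerivAt_id t).pow 2).div_const 2).smul_const (D v v)
    have hvalue : (fderiv ℝ f (x + t • v) - fderiv ℝ f x - D (t • v)) v =
        fderiv ℝ f (x + t • v) v - fderiv ℝ f x v - t • D v v := by simp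
    rw [hvalue]
    exact (((hf t ht).hasFDerivAt.comp_hasDerivAt t hline).sub hlin).sub hquad
  have hmvt := norm_image_sub_le_of_norm_deriv_le_segment_01'
    (fun t ht => (hφ' t ht).hasDerivWithinAt) fun t ht =>
      (ContinuousLinearMap.le_opNorm _ v).trans
        (mul_le_mul_of_nonneg_right (hD t ⟨ht.1, ht.2.le⟩) (norm_nonneg v))
  have hφ01 : φ 1 - φ 0 = f (x + v) - f x - fderiv ℝ f x v - (1 / 2 : ℝ) • D v v := by
    simp only [hφ, one_smul, zero_smul, one_pow, add_zero]
    simp only [ne_eq, OfNat.ofNat_ne_zero, not_false_eq_true, zero_pow, zero_div, zero_smul]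
    abel
  rwa [hφ01] at hmvt

theorem exists_norm_taylor_two_le (hf : ContDiffAt ℝ 2 f x) {η : ℝ} (hη : 0 < η) :
    ∃ ρ > 0, ∀ v : V, ‖v‖ < ρ → ‖f (x + v) - f x - fderiv ℝ f x v -
      (1 / 2 : ℝ) • fderiv ℝ (fderiv ℝ f) x v v‖ ≤ η * ‖v‖ ^ 2 := by
  have hf' : DifferentiableAt ℝ (fderiv ℝ f) x :=
    (hf.fderiv_right (m := 1) (by norm_num)).differentiableAt (by norm_num)
  have hdiff : ∀ᶠ z in 𝓝 x, DifferentiableAt ℝ f z :=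
    (hf.eventually (by simp)).mono fun z hz => hz.differentiableAt (by norm_num)
  obtain ⟨ρ, hρ, hball⟩ :=
    Metric.eventually_nhds_iff.mp ((hf'.hasFDerivAt.isLittleO.def hη).and hdiff)
  refine ⟨ρ, hρ, fun v hv => ?_⟩
  have htv : ∀ t ∈ Set.Icc (0 : ℝ) 1, ‖t • v‖ ≤ ‖v‖ := fun t ht => by
    rw [norm_smul, Real.norm_of_nonneg ht.1]
    exact mul_le_of_le_one_left (norm_nonneg v) ht.2
  have hseg : ∀ t ∈ Set.Icc (0 : ℝ) 1, dist (x + t • v) x < ρ := fun t ht => by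
    simpa using (htv t ht).trans_lt hv
  rw [sq, ← mul_assoc]
  refine norm_taylor_two_le_of_norm_fderiv_sub_le _ (fun t ht => (hball (hseg t ht)).2)
    fun t ht => ?_
  have hlocal := (hball (hseg t ht)).1
  rw [add_sub_cancel_left] at hlocal
  exact hlocal.trans (mul_le_mul_of_nonneg_left (htv t ht) hη.le)

theorem eventually_norm_taylor_two_smul_le (hf : ContDiffAt ℝ 2 f x) {R η : ℝ} (hR : 0 < R)
    (hη : 0 < η) :
    ∀ᶠ t in 𝓝 (0 : ℝ), ∀ u : V, ‖u‖ ≤ R → ‖f (x + t • u) - f x - t • fderiv ℝ f x u -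
      (t ^ 2 / 2) • fderiv ℝ (fderiv ℝ f) x u u‖ ≤ η * t ^ 2 := by
  obtain ⟨ρ, hρ, htaylor⟩ := exists_norm_taylor_two_le hf (div_pos hη (pow_pos hR 2))
  filter_upwards [Metric.ball_mem_nhds (0 : ℝ) (div_pos hρ hR)] with t ht u hu
  rw [mem_ball_zero_iff, lt_div_iff₀ hR] at ht
  have hnorm : ‖t • u‖ ≤ ‖t‖ * R := (norm_smul_le t u).trans (by gcongr)
  have hv := htaylor (t • u) (hnorm.trans_lt ht)
  simp only [map_smul, _root_.smul_apply, smul_smul] at hv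
  rw [show (1 / 2 : ℝ) * (t * t) = t ^ 2 / 2 by ring] at hv
  calc _ ≤ η / R ^ 2 * ‖t • u‖ ^ 2 := hv
    _ ≤ η / R ^ 2 * (‖t‖ * R) ^ 2 := by gcongr
    _ = η * t ^ 2 := by
        rw [Real.norm_eq_abs, mul_pow, sq_abs]
        field_simp

theorem fderiv_fderiv_eq_sum_hessian {w : ℕ} {f : E w → ℝ} {x : E w} (hf : ContDiffAt ℝ 2 f x)
    (v : E w) :
    fderiv ℝ (fderiv ℝ f) x v v = ∑ j, ∑ k, v j * v k * hessian f x j k := by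
  have hf' : DifferentiableAt ℝ (fderiv ℝ f) x :=
    (hf.fderiv_right (m := 1) (by norm_num)).differentiableAt (by norm_num)
  have hhess : ∀ j k, hessian f x j k = fderiv ℝ (fderiv ℝ f) x (EuclideanSpace.single j 1)
      (EuclideanSpace.single k 1) := by
    intro j k
    rw [hessian, Matrix.of_apply, fderiv_clm_apply hf' (differentiableAt_const _)]
    simp
  have hv : v = ∑ j, v j • EuclideanSpace.single j (1 : ℝ) := by
    ext i
    simp [Finset.sum_apply, Pi.single_apply]
  conv_lhs => rw [hv]
  simp only [map_sum, map_smul, _root_.sum_apply, _root_.smul_apply, smul_eq_mul, hhess,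
    Finset.mul_sum, mul_assoc]
  rw [Finset.sum_comm]
  exact Finset.sum_congr rfl fun j _ => Finset.sum_congr rfl fun k _ => by ring

end Taylor

section KernelMoments

variable {w : ℕ} {K : E w → ℝ} {μ₂ ν₀ ν₂ : ℝ}

theorem KernelAssumption.continuous_kernelScore (hK : KernelAssumption K μ₂ ν₀ ν₂) :
    Continuous (kernelScore K) := hK.continuous.smul continuous_id

theorem KernelAssumption.hasCompactSupport_kernelScore (hK : KernelAssumption K μ₂ ν₀ ν₂) :
    HasCompactSupport (kernelScore K) := hK.compact_support.smul_right

theorem KernelAssumption.continuous_kernelScore_apply (hK : KernelAssumption K μ₂ ν₀ ν₂)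
    (j : Fin w) : Continuous fun u => kernelScore K u j :=
  (EuclideanSpace.proj (𝕜 := ℝ) j).continuous.comp hK.continuous_kernelScore

theorem KernelAssumption.hasCompactSupport_kernelScore_apply (hK : KernelAssumption K μ₂ ν₀ ν₂)
    (j : Fin w) : HasCompactSupport fun u => kernelScore K u j :=
  hK.hasCompactSupport_kernelScore.comp_left (g := fun v : E w => v j) rfl

theorem KernelAssumption.exists_norm_kernelScore_le (hK : KernelAssumption K μ₂ ν₀ ν₂) :
    ∃ C, ∀ u, ‖kernelScore K u‖ ≤ C :=
  hK.hasCompactSupport_kernelScore.exists_bound_of_continuous hK.continuous_kernelScore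

theorem KernelAssumption.exists_eq_zero_of_lt_norm (hK : KernelAssumption K μ₂ ν₀ ν₂) :
    ∃ R, 0 < R ∧ ∀ u, R < ‖u‖ → K u = 0 := by
  obtain ⟨R, hR, hsub⟩ := hK.compact_support.isCompact.isBounded.exists_pos_norm_le
  exact ⟨R, hR, fun u hu => image_eq_zero_of_notMem_tsupport fun hmem => hu.not_ge (hsub u hmem)⟩

theorem KernelAssumption.integral_kernelScore_apply (hK : KernelAssumption K μ₂ ν₀ ν₂)
    (j : Fin w) : ∫ u, kernelScore K u j = 0 := by
  rw [integral_apply_coord (hK.continuous_kernelScore.integrable_of_hasCompactSupport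
    hK.hasCompactSupport_kernelScore)]
  simp only [kernelScore, hK.first_moment, PiLp.zero_apply]

theorem KernelAssumption.integral_kernelScore_mul (hK : KernelAssumption K μ₂ ν₀ ν₂)
    (j k : Fin w) :
    ∫ u, kernelScore K u j * kernelScore K u k =
      ν₂ * (1 : Matrix (Fin w) (Fin w) ℝ) j k := by
  rw [← smul_eq_mul, ← Matrix.smul_apply, ← hK.sq_second_moment j k]
  refine integral_congr_ae (Eventually.of_forall fun u => ?_)
  simp only [kernelScore, PiLp.smul_apply, smul_eq_mul]
  ring

theorem KernelAssumption.integral_mul_quadratic (hK : KernelAssumption K μ₂ ν₀ ν₂)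
    (H : Matrix (Fin w) (Fin w) ℝ) :
    ∫ u : E w, K u * ∑ j, ∑ k, u j * u k * H j k = H.trace * μ₂ := by
  have hcont := hK.continuous
  have hint : ∀ j k, Integrable fun u : E w => H j k * (u j * u k * K u) := fun j k =>
    (Continuous.integrable_of_hasCompactSupport (by fun_prop)
      hK.compact_support.mul_left).const_mul _
  have hexpand : ∀ u : E w, K u * ∑ j, ∑ k, u j * u k * H j k =
      ∑ j, ∑ k, H j k * (u j * u k * K u) := by
    intro u
    simp only [Finset.mul_sum]
    exact Finset.sum_congr rfl fun j _ => Finset.sum_congr rfl fun k _ => by ring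
  simp_rw [hexpand]
  rw [integral_finsetSum _ fun j _ => integrable_finsetSum _ fun k _ => hint j k]
  simp_rw [integral_finsetSum _ fun k _ => hint _ k, integral_const_mul, hK.second_moment]
  simp [Matrix.one_apply, Matrix.trace, Finset.sum_mul]

end KernelMoments

section ConditionalCentering

variable {w : ℕ} {κ : Kernel (E w) ℝ} {y : ℝ}

theorem measurable_condCDF (κ : Kernel (E w) ℝ) (y : ℝ) : Measurable (condCDF κ y) :=
  (Kernel.measurable_coe κ measurableSet_Iic).ennreal_toReal

/-- The deviation `1(b ≤ y) - F(y | z)` of the indicator response from its conditional mean; it is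
the noise of the estimator. -/
noncomputable def cdfNoise (κ : Kernel (E w) ℝ) (y : ℝ) (z : E w × ℝ) : ℝ :=
  Set.indicator (Set.Iic y) (fun _ => (1 : ℝ)) z.2 - condCDF κ y z.1

theorem measurable_cdfNoise (κ : Kernel (E w) ℝ) (y : ℝ) : Measurable (cdfNoise κ y) :=
  ((measurable_const.indicator measurableSet_Iic).comp measurable_snd).sub
    ((measurable_condCDF κ y).comp measurable_fst)

theorem abs_cdfNoise_le_one [IsMarkovKernel κ] (z : E w × ℝ) : |cdfNoise κ y z| ≤ 1 := by
  have hnonneg : 0 ≤ condCDF κ y z.1 := measureReal_nonneg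
  have hle : condCDF κ y z.1 ≤ 1 := measureReal_le_one
  rw [cdfNoise, abs_le]
  by_cases hz : z.2 ∈ Set.Iic y
  · rw [Set.indicator_of_mem hz]
    constructor <;> linarith
  · rw [Set.indicator_of_notMem hz]
    constructor <;> linarith

theorem integral_mul_cdfNoise {Ω : Type*} [MeasurableSpace Ω] {μ : Measure Ω} [IsFiniteMeasure μ]
    {X : Ω → E w} {Y : Ω → ℝ} [IsMarkovKernel κ] (hκ : HasCondDistrib Y X κ μ)
    (hX : Measurable X) (hY : Measurable Y) {ψ : E w → ℝ} (hψ : Measurable ψ) {C : ℝ}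
    (hC : ∀ z, |ψ z| ≤ C) :
    ∫ ω, ψ (X ω) * cdfNoise κ y (X ω, Y ω) ∂μ = 0 := by
  have hmeas : Measurable fun z : E w × ℝ => ψ z.1 * cdfNoise κ y z :=
    (hψ.comp measurable_fst).mul (measurable_cdfNoise κ y)
  have hinner : ∀ z, ∫ b, cdfNoise κ y (z, b) ∂κ z = 0 := by
    intro z
    simp only [cdfNoise]
    rw [integral_sub ((integrable_const 1).indicator measurableSet_Iic) (integrable_const _),
      integral_indicator_const _ measurableSet_Iic]
    simp [condCDF]
  have hbound : ∀ z : E w × ℝ, ‖ψ z.1 * cdfNoise κ y z‖ ≤ C := fun z => by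
    rw [norm_mul, Real.norm_eq_abs, Real.norm_eq_abs]
    exact (mul_le_of_le_one_right (abs_nonneg _) (abs_cdfNoise_le_one z)).trans (hC z.1)
  rw [← integral_map (hX.prodMk hY).aemeasurable
      (f := fun z : E w × ℝ => ψ z.1 * cdfNoise κ y z) hmeas.aestronglyMeasurable, hκ.map_eq,
    Measure.integral_compProd (Integrable.of_bound hmeas.aestronglyMeasurable C
      (Eventually.of_forall hbound))]
  simp only [integral_const_mul, hinner, mul_zero, integral_zero]

end ConditionalCentering

section NearlyIsotropic

variable {A : Type*} [MeasurableSpace A] {ν : Measure A} {w : ℕ} {W : A → E w} {N c s : ℝ}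

/-- After division by `N`, the random vector `W` has mean zero and second moment matrix `c • 1`, up
to an error `s` in each entry. -/
structure IsNearlyIsotropic (ν : Measure A) (W : A → E w) (N c s : ℝ) : Prop where
  mean : ∀ j, |N⁻¹ * ∫ a, W a j ∂ν| ≤ s
  second_moment : ∀ j k,
    |N⁻¹ * ∫ a, W a j * W a k ∂ν - c * (1 : Matrix (Fin w) (Fin w) ℝ) j k| ≤ s

theorem abs_sum_sum_mul_le {a : Matrix (Fin w) (Fin w) ℝ} (ha : ∀ j k, |a j k| ≤ s) (e : E w) :
    |∑ j, ∑ k, e j * e k * a j k| ≤ w ^ 2 * s * ‖e‖ ^ 2 := by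
  have hterm : ∀ j k, |e j * e k * a j k| ≤ ‖e‖ * ‖e‖ * s := fun j k => by
    rw [abs_mul, abs_mul]
    gcongr
    · exact PiLp.norm_apply_le e j
    · exact PiLp.norm_apply_le e k
    · exact ha j k
  calc |∑ j, ∑ k, e j * e k * a j k| ≤ ∑ _j : Fin w, ∑ _k : Fin w, ‖e‖ * ‖e‖ * s :=
        (Finset.abs_sum_le_sum_abs _ _).trans (Finset.sum_le_sum fun j _ =>
          (Finset.abs_sum_le_sum_abs _ _).trans (Finset.sum_le_sum fun k _ => hterm j k))
    _ = w ^ 2 * s * ‖e‖ ^ 2 := by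
        simp only [Finset.sum_const, Finset.card_univ, Fintype.card_fin, nsmul_eq_mul]
        ring

theorem integral_inner_sq_eq_sum (hW : ∀ j k, Integrable (fun a => W a j * W a k) ν) (e : E w) :
    ∫ a, ⟪e, W a⟫ ^ 2 ∂ν = ∑ j, ∑ k, e j * e k * ∫ a, W a j * W a k ∂ν := by
  have hexpand : ∀ a, ⟪e, W a⟫ ^ 2 = ∑ j, ∑ k, e j * e k * (W a j * W a k) := fun a => by
    rw [PiLp.inner_apply, sq, Finset.sum_mul_sum]
    refine Finset.sum_congr rfl fun j _ => Finset.sum_congr rfl fun k _ => ?_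
    simp only [RCLike.inner_apply, conj_trivial]
    ring
  simp_rw [hexpand]
  rw [integral_finsetSum _ fun j _ => integrable_finsetSum _ fun k _ => (hW j k).const_mul _]
  refine Finset.sum_congr rfl fun j _ => ?_
  rw [integral_finsetSum _ fun k _ => (hW j k).const_mul _]
  simp_rw [integral_const_mul]

theorem IsNearlyIsotropic.le_integral_inner_sq (hiso : IsNearlyIsotropic ν W N c s)
    (hW : ∀ j k, Integrable (fun a => W a j * W a k) ν) (hN : 0 < N) (e : E w) :
    (c - w ^ 2 * s) * N * ‖e‖ ^ 2 ≤ ∫ a, ⟪e, W a⟫ ^ 2 ∂ν := by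
  have hnorm : ‖e‖ ^ 2 = ∑ j, ∑ k, e j * e k * (1 : Matrix (Fin w) (Fin w) ℝ) j k := by
    rw [EuclideanSpace.norm_sq_eq]
    simp [Matrix.one_apply, sq]
  have hdiff : ∑ j, ∑ k, e j * e k *
        (N⁻¹ * ∫ a, W a j * W a k ∂ν - c * (1 : Matrix (Fin w) (Fin w) ℝ) j k) =
      N⁻¹ * ∫ a, ⟪e, W a⟫ ^ 2 ∂ν - c * ‖e‖ ^ 2 := by
    rw [integral_inner_sq_eq_sum hW, hnorm]
    simp only [Finset.mul_sum, ← Finset.sum_sub_distrib]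
    exact Finset.sum_congr rfl fun j _ => Finset.sum_congr rfl fun k _ => by ring
  have hclose := abs_sum_sum_mul_le (a := Matrix.of fun j k =>
    N⁻¹ * ∫ a, W a j * W a k ∂ν - c * (1 : Matrix (Fin w) (Fin w) ℝ) j k) hiso.second_moment e
  simp only [Matrix.of_apply] at hclose
  rw [hdiff] at hclose
  have hscaled : (c - w ^ 2 * s) * ‖e‖ ^ 2 ≤ N⁻¹ * ∫ a, ⟪e, W a⟫ ^ 2 ∂ν := by
    linarith [(abs_le.mp hclose).1]
  rw [← div_eq_inv_mul, le_div_iff₀ hN] at hscaled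
  linarith

theorem IsNearlyIsotropic.norm_integral_le (hiso : IsNearlyIsotropic ν W N c s)
    (hW : Integrable W ν) (hN : 0 < N) : ‖∫ a, W a ∂ν‖ ≤ w * s * N := by
  have hcoord : ∀ j, |(∫ a, W a ∂ν) j| ≤ s * N := fun j => by
    have := hiso.mean j
    rwa [integral_apply_coord hW, abs_mul, abs_of_pos (inv_pos.mpr hN), ← div_eq_inv_mul,
      div_le_iff₀ hN] at this
  calc ‖∫ a, W a ∂ν‖ ≤ ∑ j, |(∫ a, W a ∂ν) j| := norm_le_sum_abs _
    _ ≤ ∑ _j : Fin w, s * N := Finset.sum_le_sum fun j _ => hcoord j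
    _ = w * s * N := by
        simp only [Finset.sum_const, Finset.card_univ, Fintype.card_fin, nsmul_eq_mul]
        ring

theorem IsNearlyIsotropic.exists_isMultiplier [IsFiniteMeasure ν]
    (hiso : IsNearlyIsotropic ν W N c s) (hW : AEStronglyMeasurable W ν) (hN : 0 < N) {C r : ℝ}
    (hC : ∀ a, ‖W a‖ ≤ C) (hr : 0 < r) (hrC : r * C ≤ 1 / 8) (hs : w * s < c * r / 8)
    (hs' : w ^ 2 * s ≤ c / 2) :
    (∀ e, c / 2 * N * ‖e‖ ^ 2 ≤ ∫ a, ⟪e, W a⟫ ^ 2 ∂ν) ∧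
      ∃ l : E w, ‖l‖ < r ∧ IsMultiplier ν W l := by
  have hmeas : ∀ j, AEStronglyMeasurable (fun a => W a j) ν := fun j =>
    (EuclideanSpace.proj (𝕜 := ℝ) j).continuous.comp_aestronglyMeasurable hW
  have hcoord : ∀ j a, ‖W a j‖ ≤ C := fun j a => (PiLp.norm_apply_le (W a) j).trans (hC a)
  have hint : ∀ j k, Integrable (fun a => W a j * W a k) ν := fun j k =>
    (Integrable.of_bound (hmeas k) C (Eventually.of_forall (hcoord k))).bdd_mul (hmeas j)
      (Eventually.of_forall (hcoord j))
  have hquad : ∀ e, c / 2 * N * ‖e‖ ^ 2 ≤ ∫ a, ⟪e, W a⟫ ^ 2 ∂ν := fun e => by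
    refine le_trans ?_ (hiso.le_integral_inner_sq hint hN e)
    gcongr
    linarith
  refine ⟨hquad, RNW.exists_isMultiplier hW hC hr hrC ?_ hquad⟩
  calc ‖∫ a, W a ∂ν‖ ≤ w * s * N :=
        hiso.norm_integral_le (Integrable.of_bound hW C (Eventually.of_forall hC)) hN
    _ < c * r / 8 * N := mul_lt_mul_of_pos_right hs hN
    _ = c / 2 * N * r / 4 := by ring

theorem exists_isotropy_tolerance (w : ℕ) {c r : ℝ} (hc : 0 < c) (hr : 0 < r) :
    ∃ s : ℝ, 0 < s ∧ w * s < c * r / 8 ∧ w ^ 2 * s ≤ c / 2 := by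
  obtain ⟨s, hs, hlt⟩ := exists_pos_mul_lt
    (lt_min (by positivity : 0 < c * r / 8) (half_pos hc)) (w + w ^ 2 : ℝ)
  have hmean : 0 ≤ w * s := by positivity
  have hsecond : 0 ≤ w ^ 2 * s := by positivity
  rw [add_mul, lt_min_iff] at hlt
  exact ⟨s, hs, by linarith, by linarith⟩

end NearlyIsotropic

section LocalMultiplier

variable {Ω : Type*} [MeasurableSpace Ω] {μ : Measure Ω} {w : ℕ} {X : ℕ → Ω → E w}
  {Y : ℕ → Ω → ℝ} {x : E w} {h : ℕ → ℝ} {γ : ℝ} {K : E w → ℝ} {μ₂ ν₀ ν₂ : ℝ}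

theorem IsLocallyRegular.eventually_isNearlyIsotropic (hreg : IsLocallyRegular μ X Y x h γ)
    (hK : KernelAssumption K μ₂ ν₀ ν₂) {s : ℝ} (hs : 0 < s) :
    ∀ᶠ n in atTop, IsNearlyIsotropic μ (fun ω => kernelScore K (zoom (h n) x (X 0 ω)))
      (h n ^ w) (γ * ν₂) s := by
  have hcont := hK.continuous_kernelScore_apply
  have hsupp := hK.hasCompactSupport_kernelScore_apply
  have hclose : ∀ φ : E w → ℝ, Continuous φ → HasCompactSupport φ → ∀ᶠ n in atTop,
      |(h n ^ w)⁻¹ * ∫ ω, φ (zoom (h n) x (X 0 ω)) ∂μ - γ * ∫ u, φ u| ≤ s := fun φ hφ hφs =>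
    (Metric.tendsto_nhds.mp (hreg.tendsto_mean φ hφ hφs) s hs).mono fun n hn => hn.le
  filter_upwards [eventually_all.mpr fun j => hclose _ (hcont j) (hsupp j),
    eventually_all.mpr fun j => eventually_all.mpr fun k =>
      hclose _ ((hcont j).mul (hcont k)) (hsupp j).mul_right] with n hmean hsecond
  refine ⟨fun j => ?_, fun j k => ?_⟩
  · simpa only [hK.integral_kernelScore_apply, mul_zero, sub_zero] using hmean j
  · simpa only [Pi.mul_apply, hK.integral_kernelScore_mul, ← mul_assoc] using hsecond j k

theorem IsLocallyRegular.withHighProb_isNearlyIsotropic [IsFiniteMeasure μ]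
    (hreg : IsLocallyRegular μ X Y x h γ) (hK : KernelAssumption K μ₂ ν₀ ν₂) {s : ℝ}
    (hs : 0 < s) :
    WithHighProb μ fun n ω => IsNearlyIsotropic Measure.count
      (fun i : Fin n => kernelScore K (zoom (h n) x (X i ω))) (n * h n ^ w) (γ * ν₂) s := by
  have hcont := hK.continuous_kernelScore_apply
  have hsupp := hK.hasCompactSupport_kernelScore_apply
  refine ((WithHighProb.forall fun j =>
    hreg.withHighProb_abs_average_sub_le (hcont j) (hsupp j) hs).and
    (WithHighProb.forall fun j => WithHighProb.forall fun k =>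
      hreg.withHighProb_abs_average_sub_le ((hcont j).mul (hcont k)) (hsupp j).mul_right hs)).mono
    (Eventually.of_forall fun n ω hω => ⟨fun j => ?_, fun j k => ?_⟩)
  · simpa only [integral_count, hK.integral_kernelScore_apply, mul_zero, sub_zero] using hω.1 j
  · simpa only [integral_count, Pi.mul_apply, hK.integral_kernelScore_mul, ← mul_assoc]
      using hω.2 j k

theorem IsLocallyRegular.eventually_exists_isMultiplier [IsFiniteMeasure μ]
    (hreg : IsLocallyRegular μ X Y x h γ) (hK : KernelAssumption K μ₂ ν₀ ν₂) {C r : ℝ}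
    (hC : ∀ u, ‖kernelScore K u‖ ≤ C) (hr : 0 < r) (hrC : r * C ≤ 1 / 8) :
    ∀ᶠ n in atTop, ∃ l : E w, ‖l‖ < r ∧
      IsMultiplier μ (fun ω => kernelScore K (zoom (h n) x (X 0 ω))) l := by
  obtain ⟨s, hs, hmean, hsecond⟩ := exists_isotropy_tolerance w
    (mul_pos hreg.intensity_pos hK.sq_second_moment_pos) hr
  filter_upwards [hreg.eventually_isNearlyIsotropic hK hs] with n hiso
  exact (hiso.exists_isMultiplier ((hK.continuous_kernelScore.comp
    (continuous_zoom (h n) x)).measurable.comp (hreg.measurable_fst 0)).aestronglyMeasurable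
    (pow_pos (hreg.bandwidth_pos n) w) (fun ω => hC _) hr hrC hmean hsecond).2

theorem IsLocallyRegular.withHighProb_eq_multiplierWeight [IsFiniteMeasure μ]
    (hreg : IsLocallyRegular μ X Y x h γ) (hK : KernelAssumption K μ₂ ν₀ ν₂) {C r : ℝ}
    (hC : ∀ u, ‖kernelScore K u‖ ≤ C) (hr : 0 < r) (hrC : r * C ≤ 1 / 8)
    {p : ∀ n : ℕ, Ω → Fin n → ℝ}
    (hp : ∀ n ω, (∃ q, IsAdjustmentWeights K (h n) x (fun i : Fin n => X i ω) q) →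
      IsAdjustmentWeights K (h n) x (fun i : Fin n => X i ω) (p n ω)) :
    WithHighProb μ fun n ω =>
      (∀ e : E w, γ * ν₂ / 2 * (n * h n ^ w) * ‖e‖ ^ 2 ≤
        ∑ i : Fin n, ⟪e, kernelScore K (zoom (h n) x (X i ω))⟫ ^ 2) ∧
      ∃ l : E w, ‖l‖ < r ∧
        IsMultiplier Measure.count (fun i : Fin n => kernelScore K (zoom (h n) x (X i ω))) l ∧
        p n ω = multiplierWeight (fun i : Fin n => kernelScore K (zoom (h n) x (X i ω))) l := by
  obtain ⟨s, hs, hmean, hsecond⟩ := exists_isotropy_tolerance w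
    (mul_pos hreg.intensity_pos hK.sq_second_moment_pos) hr
  refine (hreg.withHighProb_isNearlyIsotropic hK hs).mono ?_
  filter_upwards [hreg.eventually_pos] with n hN ω hiso
  obtain ⟨hquad, l, hl, hmul⟩ := hiso.exists_isMultiplier
    (measurable_of_finite _).aestronglyMeasurable hN (fun i => hC _) hr hrC hmean hsecond
  have hn : n ≠ 0 := by
    rintro rfl
    simp at hN
  have hpos : ∀ i : Fin n, 0 < 1 + ⟪l, kernelScore K (zoom (h n) x (X i ω))⟫ := fun i => by
    linarith [seven_eighths_le_one_add_inner (hC (zoom (h n) x (X i ω))) hl.le hrC]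
  refine ⟨fun e => by simpa only [integral_count] using hquad e, l, hl, hmul, ?_⟩
  exact (hp n ω ⟨_, isAdjustmentWeights_multiplierWeight (hreg.bandwidth_pos n) hn hpos
    hmul⟩).eq_multiplierWeight (hreg.bandwidth_pos n) hn hpos hmul

end LocalMultiplier

section TiltedAverage

variable {w : ℕ} {K : E w → ℝ} {C r : ℝ} {l l' u : E w}

/-- The kernel reweighted by the likelihood tilt `1 / (1 + ⟪l, K(u) u⟫)`. -/
noncomputable def tiltedKernel (K : E w → ℝ) (l u : E w) : ℝ :=
  (1 + ⟪l, kernelScore K u⟫)⁻¹ * K u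

theorem tiltedKernel_zero (K : E w → ℝ) : tiltedKernel K 0 = K := by
  ext u
  simp [tiltedKernel]

theorem tiltedKernel_smul_self (K : E w → ℝ) (l u : E w) :
    tiltedKernel K l u • u = (1 + ⟪l, kernelScore K u⟫)⁻¹ • kernelScore K u :=
  mul_smul _ _ _

theorem tiltedKernel_eq_zero (l : E w) (hu : K u = 0) : tiltedKernel K l u = 0 := by
  rw [tiltedKernel, hu, mul_zero]

theorem half_mul_le_tiltedKernel (hK : 0 ≤ K u) (hC : ‖kernelScore K u‖ ≤ C) (hl : ‖l‖ ≤ r)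
    (hrC : r * C ≤ 1 / 8) : 1 / 2 * K u ≤ tiltedKernel K l u := by
  have htilt := abs_le.mp (abs_inner_le_of_norm_le hC hl hrC)
  refine mul_le_mul_of_nonneg_right ?_ hK
  rw [one_div]
  exact inv_anti₀ (by linarith) (by linarith)

theorem tiltedKernel_nonneg (hK : 0 ≤ K u) (hC : ‖kernelScore K u‖ ≤ C) (hl : ‖l‖ ≤ r)
    (hrC : r * C ≤ 1 / 8) : 0 ≤ tiltedKernel K l u :=
  (by positivity : 0 ≤ 1 / 2 * K u).trans (half_mul_le_tiltedKernel hK hC hl hrC)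

theorem abs_tiltedKernel_le {D : ℝ} (hD : |K u| ≤ D) (hC : ‖kernelScore K u‖ ≤ C) (hl : ‖l‖ ≤ r)
    (hrC : r * C ≤ 1 / 8) : |tiltedKernel K l u| ≤ 2 * D := by
  have htilt := seven_eighths_le_one_add_inner hC hl hrC
  rw [tiltedKernel, abs_mul, abs_of_pos (inv_pos.mpr (by linarith))]
  refine mul_le_mul ?_ hD (abs_nonneg _) zero_le_two
  rw [inv_le_comm₀ (by linarith) zero_lt_two]
  linarith

theorem abs_tiltedKernel_sub_le (hK : 0 ≤ K u) (hC : ‖kernelScore K u‖ ≤ C) (hl : ‖l‖ ≤ r)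
    (hl' : ‖l'‖ ≤ r) (hrC : r * C ≤ 1 / 8) :
    |tiltedKernel K l u - tiltedKernel K l' u| ≤ 2 * (‖l - l'‖ * C) * K u := by
  have ha := seven_eighths_le_one_add_inner hC hl hrC
  have hb := seven_eighths_le_one_add_inner hC hl' hrC
  have hdiff : |⟪l - l', kernelScore K u⟫| ≤ ‖l - l'‖ * C :=
    (abs_real_inner_le_norm _ _).trans (mul_le_mul_of_nonneg_left hC (norm_nonneg _))
  rw [inner_sub_left] at hdiff
  rw [tiltedKernel, tiltedKernel, ← sub_mul, abs_mul, abs_of_nonneg hK]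
  refine mul_le_mul_of_nonneg_right ?_ hK
  set a := ⟪l, kernelScore K u⟫
  set b := ⟪l', kernelScore K u⟫
  have hprod : 1 / 2 ≤ (1 + a) * (1 + b) := by nlinarith
  rw [inv_sub_inv (by linarith) (by linarith), abs_div,
    abs_of_pos (by linarith : 0 < (1 + a) * (1 + b)), div_le_iff₀ (by linarith),
    add_sub_add_left_eq_sub, abs_sub_comm]
  nlinarith [(abs_nonneg _).trans hdiff]

variable {ι : Type*} [Fintype ι] {u : ι → E w} {f : ι → ℝ} {B : ℝ}

/-- The average of `f` with weights proportional to the tilted kernel at the points `u i`; the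
Nadaraya-Watson average is the case `l = 0`. -/
noncomputable def tiltedAverage (K : E w → ℝ) (l : E w) (u : ι → E w) (f : ι → ℝ) : ℝ :=
  (∑ i, tiltedKernel K l (u i) * f i) / ∑ i, tiltedKernel K l (u i)

theorem tiltedAverage_add (K : E w → ℝ) (l : E w) (u : ι → E w) (f g : ι → ℝ) :
    tiltedAverage K l u (fun i => f i + g i) = tiltedAverage K l u f + tiltedAverage K l u g := by
  simp only [tiltedAverage, mul_add, Finset.sum_add_distrib, add_div]

theorem tiltedAverage_const_mul (K : E w → ℝ) (l : E w) (u : ι → E w) (a : ℝ) (f : ι → ℝ) :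
    tiltedAverage K l u (fun i => a * f i) = a * tiltedAverage K l u f := by
  simp only [tiltedAverage, mul_left_comm _ a, ← Finset.mul_sum, mul_div_assoc]

theorem tiltedAverage_const (hsum : ∑ i, tiltedKernel K l (u i) ≠ 0) (a : ℝ) :
    tiltedAverage K l u (fun _ => a) = a := by
  rw [tiltedAverage, ← Finset.sum_mul, mul_div_cancel_left₀ a hsum]

theorem tiltedAverage_linearMap (L : E w →ₗ[ℝ] ℝ)
    (hmul : ∑ i, tiltedKernel K l (u i) • u i = 0) :
    tiltedAverage K l u (fun i => L (u i)) = 0 := by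
  have hsum : ∑ i, tiltedKernel K l (u i) * L (u i) = 0 := by
    simpa using congrArg L hmul
  rw [tiltedAverage, hsum, zero_div]

theorem abs_tiltedAverage_le (hnonneg : ∀ i, 0 ≤ tiltedKernel K l (u i))
    (hpos : 0 < ∑ i, tiltedKernel K l (u i)) (hf : ∀ i, K (u i) ≠ 0 → |f i| ≤ B) :
    |tiltedAverage K l u f| ≤ B := by
  rw [tiltedAverage, abs_div, abs_of_pos hpos, div_le_iff₀ hpos, Finset.mul_sum]
  refine (Finset.abs_sum_le_sum_abs _ _).trans (Finset.sum_le_sum fun i _ => ?_)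
  rw [abs_mul, abs_of_nonneg (hnonneg i), mul_comm]
  rcases eq_or_ne (K (u i)) 0 with hzero | hne
  · simp only [tiltedKernel_eq_zero _ hzero, mul_zero, le_refl]
  · exact mul_le_mul_of_nonneg_right (hf i hne) (hnonneg i)

variable {γ N : ℝ}

theorem le_sum_tiltedKernel (hK : ∀ u, 0 ≤ K u) (hC : ∀ u, ‖kernelScore K u‖ ≤ C) (hl : ‖l‖ ≤ r)
    (hrC : r * C ≤ 1 / 8) (hdens : γ / 2 * N ≤ ∑ i, K (u i)) :
    γ / 4 * N ≤ ∑ i, tiltedKernel K l (u i) := by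
  have hhalf : 1 / 2 * ∑ i, K (u i) ≤ ∑ i, tiltedKernel K l (u i) := by
    rw [Finset.mul_sum]
    exact Finset.sum_le_sum fun i _ => half_mul_le_tiltedKernel (hK _) (hC _) hl hrC
  linarith

theorem abs_sum_tiltedKernel_mul_sub_le (hK : ∀ u, 0 ≤ K u) (hC : ∀ u, ‖kernelScore K u‖ ≤ C)
    (hl : ‖l‖ ≤ r) (hl' : ‖l'‖ ≤ r) (hrC : r * C ≤ 1 / 8)
    (hf : ∀ i, K (u i) ≠ 0 → |f i| ≤ B) :
    |∑ i, tiltedKernel K l (u i) * f i - ∑ i, tiltedKernel K l' (u i) * f i| ≤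
      2 * (‖l - l'‖ * C) * B * ∑ i, K (u i) := by
  rw [← Finset.sum_sub_distrib, Finset.mul_sum]
  refine (Finset.abs_sum_le_sum_abs _ _).trans (Finset.sum_le_sum fun i _ => ?_)
  rcases eq_or_ne (K (u i)) 0 with hzero | hne
  · simp only [tiltedKernel_eq_zero _ hzero, zero_mul, sub_zero, abs_zero, mul_zero, hzero,
      le_refl]
  · rw [← sub_mul, abs_mul, mul_right_comm _ B]
    exact mul_le_mul (abs_tiltedKernel_sub_le (hK _) (hC _) hl hl' hrC) (hf i hne) (abs_nonneg _)
      ((abs_nonneg _).trans (abs_tiltedKernel_sub_le (hK _) (hC _) hl hl' hrC))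

theorem abs_tiltedAverage_le_of_tilt (hK : ∀ u, 0 ≤ K u) (hC : ∀ u, ‖kernelScore K u‖ ≤ C)
    (hl : ‖l‖ ≤ r) (hl' : ‖l'‖ ≤ r) (hrC : r * C ≤ 1 / 8) (hγ : 0 < γ) (hN : 0 < N)
    (hdens : γ / 2 * N ≤ ∑ i, K (u i)) (hB : 0 ≤ B) (hf : ∀ i, K (u i) ≠ 0 → |f i| ≤ B) :
    |tiltedAverage K l u f| ≤
      4 / γ * |N⁻¹ * ∑ i, tiltedKernel K l' (u i) * f i| + 4 * B * (‖l - l'‖ * C) := by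
  set T := ∑ i, tiltedKernel K l (u i) with hT
  have hTN : γ / 4 * N ≤ T := le_sum_tiltedKernel hK hC hl hrC hdens
  have hTpos : 0 < T := lt_of_lt_of_le (by positivity) hTN
  have hTK : ∑ i, K (u i) ≤ 2 * T := by
    rw [hT, Finset.mul_sum]
    refine Finset.sum_le_sum fun i _ => ?_
    linarith [half_mul_le_tiltedKernel (hK (u i)) (hC _) hl hrC]
  have hshift : 0 ≤ ‖l - l'‖ * C :=
    mul_nonneg (norm_nonneg _) ((norm_nonneg _).trans (hC 0))
  have hNT : N ≤ 4 / γ * T := by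
    rw [div_mul_eq_mul_div, le_div_iff₀ hγ]
    linarith
  set S := ∑ i, tiltedKernel K l' (u i) * f i
  rw [tiltedAverage, abs_div, abs_of_pos hTpos, div_le_iff₀ hTpos]
  calc |∑ i, tiltedKernel K l (u i) * f i|
      ≤ |S| + 2 * (‖l - l'‖ * C) * B * ∑ i, K (u i) := by
        linarith [abs_sub_abs_le_abs_sub (∑ i, tiltedKernel K l (u i) * f i) S,
          abs_sum_tiltedKernel_mul_sub_le (u := u) hK hC hl hl' hrC hf]
    _ = N * |N⁻¹ * S| + 2 * (‖l - l'‖ * C) * B * ∑ i, K (u i) := by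
        rw [abs_mul, abs_of_pos (inv_pos.mpr hN), mul_inv_cancel_left₀ hN.ne']
    _ ≤ 4 / γ * T * |N⁻¹ * S| + 2 * (‖l - l'‖ * C) * B * (2 * T) := by gcongr
    _ = _ := by ring

theorem abs_tiltedAverage_sub_le_of_taylor (hK : ∀ u, 0 ≤ K u)
    (hC : ∀ u, ‖kernelScore K u‖ ≤ C) (hl : ‖l‖ ≤ r) (hrC : r * C ≤ 1 / 8)
    (hmul : ∑ i, tiltedKernel K l (u i) • u i = 0) (hγ : 0 < γ) (hN : 0 < N)
    (hdens : γ / 2 * N ≤ ∑ i, K (u i)) (L : E w →ₗ[ℝ] ℝ) {q : E w → ℝ} {b a τ η s : ℝ}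
    (ha : 0 ≤ a) (hf : ∀ i, K (u i) ≠ 0 → |f i - b - L (u i) - a * q (u i)| ≤ η * a)
    (hB : 0 ≤ B) (hq : ∀ v, K v ≠ 0 → |q v - τ| ≤ B)
    (hs : |N⁻¹ * ∑ i, K (u i) * (q (u i) - τ)| ≤ s) :
    |tiltedAverage K l u f - (b + a * τ)| ≤ (4 / γ * s + 4 * B * (r * C) + η) * a := by
  have hpos : 0 < ∑ i, tiltedKernel K l (u i) :=
    lt_of_lt_of_le (by positivity) (le_sum_tiltedKernel hK hC hl hrC hdens)
  have hC0 : 0 ≤ C := (norm_nonneg _).trans (hC 0)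
  have hr0 : 0 ≤ r := (norm_nonneg _).trans hl
  have hsplit : f = fun i => (b + a * τ) + (L (u i) + (a * (q (u i) - τ) +
      (f i - b - L (u i) - a * q (u i)))) := by
    ext i
    ring
  have hquad : |tiltedAverage K l u fun i => q (u i) - τ| ≤ 4 / γ * s + 4 * B * (r * C) := by
    have htilt := abs_tiltedAverage_le_of_tilt (l' := 0) (f := fun i => q (u i) - τ) hK hC hl
      (by simpa using hr0) hrC hγ hN hdens hB fun i hi => hq _ hi
    rw [tiltedKernel_zero, sub_zero] at htilt
    refine htilt.trans ?_
    gcongr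
  have hrem := abs_tiltedAverage_le (u := u) (f := fun i => f i - b - L (u i) - a * q (u i))
    (fun i => tiltedKernel_nonneg (hK _) (hC _) hl hrC) hpos hf
  rw [hsplit, tiltedAverage_add, tiltedAverage_const hpos.ne', tiltedAverage_add,
    tiltedAverage_linearMap L hmul, tiltedAverage_add, tiltedAverage_const_mul, add_sub_cancel_left,
    zero_add, add_mul]
  refine (abs_add_le _ _).trans (add_le_add ?_ hrem)
  rw [abs_mul, abs_of_nonneg ha, mul_comm]
  exact mul_le_mul_of_nonneg_right hquad ha

theorem abs_tiltedAverage_le_of_isMultiplier {n : ℕ} {u : Fin n → E w} {f : Fin n → ℝ} {v : ℝ}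
    (hK : ∀ u, 0 ≤ K u) (hC : ∀ u, ‖kernelScore K u‖ ≤ C) (hl : ‖l‖ ≤ r) (hl' : ‖l'‖ ≤ r)
    (hrC : r * C ≤ 1 / 8) (hγ : 0 < γ) (hN : 0 < N) (hv : 0 < v)
    (hmul : IsMultiplier Measure.count (fun i => kernelScore K (u i)) l)
    (hquad : ∀ e, v * N * ‖e‖ ^ 2 ≤ ∑ i, ⟪e, kernelScore K (u i)⟫ ^ 2)
    (hdens : γ / 2 * N ≤ ∑ i, K (u i)) (hf : ∀ i, |f i| ≤ 1) :
    |tiltedAverage K l u f| ≤ (4 / γ + 8 * C / v) *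
      (|N⁻¹ * ∑ i, tiltedKernel K l' (u i) * f i| +
        N⁻¹ * ‖∑ i, tiltedKernel K l' (u i) • u i‖) := by
  have hC0 : 0 ≤ C := (norm_nonneg _).trans (hC 0)
  have hdist := norm_sub_le_of_isMultiplier_count (fun i => hC (u i)) hrC hl hl' hmul hquad
  simp only [← tiltedKernel_smul_self] at hdist
  set D := ‖∑ i, tiltedKernel K l' (u i) • u i‖
  set S := |N⁻¹ * ∑ i, tiltedKernel K l' (u i) * f i|
  have hdist' : ‖l - l'‖ ≤ 2 / v * (N⁻¹ * D) := by
    rw [mul_comm, ← le_div_iff₀ (by positivity)] at hdist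
    refine hdist.trans_eq ?_
    field_simp
  calc |tiltedAverage K l u f| ≤ 4 / γ * S + 4 * 1 * (‖l - l'‖ * C) :=
        abs_tiltedAverage_le_of_tilt hK hC hl hl' hrC hγ hN hdens zero_le_one fun i _ => hf i
    _ ≤ 4 / γ * S + 4 * 1 * (2 / v * (N⁻¹ * D) * C) := by gcongr
    _ = 4 / γ * S + 8 * C / v * (N⁻¹ * D) := by ring
    _ ≤ (4 / γ + 8 * C / v) * S + (4 / γ + 8 * C / v) * (N⁻¹ * D) := by
        gcongr
        · exact le_add_of_nonneg_right (by positivity)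
        · exact le_add_of_nonneg_left (by positivity)
    _ = _ := by ring

theorem sum_finalWeight_multiplierWeight_mul {n : ℕ} (K : E w → ℝ) {h : ℝ} (hh : h ≠ 0) (x : E w)
    (xs : Fin n → E w) (l : E w) (f : Fin n → ℝ) :
    ∑ i, finalWeight K h x xs
        (multiplierWeight (fun i => kernelScore K (zoom h x (xs i))) l) i * f i =
      tiltedAverage K l (fun i => zoom h x (xs i)) f := by
  rcases eq_or_ne n 0 with rfl | hn
  · simp [tiltedAverage]
  have hscale : ((n : ℝ) * h ^ w)⁻¹ ≠ 0 :=
    inv_ne_zero (mul_ne_zero (mod_cast hn) (pow_ne_zero w hh))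
  have hweight : ∀ i, multiplierWeight (fun i => kernelScore K (zoom h x (xs i))) l i *
      scaledKernel K h (xs i - x) =
        ((n : ℝ) * h ^ w)⁻¹ * tiltedKernel K l (zoom h x (xs i)) := fun i => by
    rw [multiplierWeight, scaledKernel, tiltedKernel, zoom, mul_inv, mul_inv]
    ring
  simp only [finalWeight, hweight, ← Finset.mul_sum, mul_div_mul_left _ _ hscale]
  simp only [tiltedAverage, div_mul_eq_mul_div, Finset.sum_div]

end TiltedAverage

section Estimator

variable {Ω : Type*} [MeasurableSpace Ω] {μ : Measure Ω} {w : ℕ} {X : ℕ → Ω → E w}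
  {Y : ℕ → Ω → ℝ} {x : E w} {h : ℕ → ℝ} {γ : ℝ} {K : E w → ℝ} {μ₂ ν₀ ν₂ : ℝ}

theorem IsLocallyRegular.withHighProb_le_sum_kernel [IsFiniteMeasure μ]
    (hreg : IsLocallyRegular μ X Y x h γ) (hK : KernelAssumption K μ₂ ν₀ ν₂) :
    WithHighProb μ fun n ω =>
      γ / 2 * (n * h n ^ w) ≤ ∑ i : Fin n, K (zoom (h n) x (X i ω)) := by
  refine (hreg.withHighProb_abs_average_sub_le hK.continuous hK.compact_support
    (half_pos hreg.intensity_pos)).mono ?_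
  filter_upwards [hreg.eventually_pos] with n hN ω hω
  rw [hK.integral_one, mul_one] at hω
  rw [mul_comm, ← le_inv_mul_iff₀ hN]
  linarith [(abs_le.mp hω).1]

theorem KernelAssumption.integral_mul_fderiv_fderiv_sub (hK : KernelAssumption K μ₂ ν₀ ν₂)
    {f : E w → ℝ} (hf : ContDiffAt ℝ 2 f x) :
    ∫ u, K u * (1 / 2 * fderiv ℝ (fderiv ℝ f) x u u - 1 / 2 * (hessian f x).trace * μ₂) = 0 := by
  have hquad : Continuous fun u => fderiv ℝ (fderiv ℝ f) x u u :=
    (fderiv ℝ (fderiv ℝ f) x).continuous.clm_apply continuous_id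
  have hint : Integrable fun u => K u * fderiv ℝ (fderiv ℝ f) x u u :=
    (hK.continuous.mul hquad).integrable_of_hasCompactSupport hK.compact_support.mul_right
  have hintK : Integrable K := hK.continuous.integrable_of_hasCompactSupport hK.compact_support
  have hvalue : ∫ u, K u * fderiv ℝ (fderiv ℝ f) x u u = (hessian f x).trace * μ₂ := by
    simp only [fderiv_fderiv_eq_sum_hessian hf, hK.integral_mul_quadratic]
  simp only [mul_sub, mul_left_comm (K _) (1 / 2)]
  rw [integral_sub (hint.const_mul _) (hintK.mul_const _), integral_const_mul, integral_mul_const,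
    hvalue, hK.integral_one]
  ring

variable [IsFiniteMeasure μ] {p : ∀ n : ℕ, Ω → Fin n → ℝ}

theorem IsLocallyRegular.withHighProb_abs_bias_le (hreg : IsLocallyRegular μ X Y x h γ)
    (hK : KernelAssumption K μ₂ ν₀ ν₂)
    (hp : ∀ n ω, (∃ q, IsAdjustmentWeights K (h n) x (fun i : Fin n => X i ω) q) →
      IsAdjustmentWeights K (h n) x (fun i : Fin n => X i ω) (p n ω))
    {f : E w → ℝ} (hf : ContDiffAt ℝ 2 f x) {B C r η : ℝ} (hB : 0 ≤ B)
    (hquad : ∀ u, K u ≠ 0 →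
      |1 / 2 * fderiv ℝ (fderiv ℝ f) x u u - 1 / 2 * (hessian f x).trace * μ₂| ≤ B)
    (hC : ∀ u, ‖kernelScore K u‖ ≤ C) (hr : 0 < r) (hrC : r * C ≤ 1 / 8) (hη : 0 < η) :
    WithHighProb μ fun n ω =>
      |∑ i : Fin n, finalWeight K (h n) x (fun i : Fin n => X i ω) (p n ω) i * f (X i ω) -
        (f x + h n ^ 2 * (1 / 2 * (hessian f x).trace * μ₂))| ≤
          (4 / γ * η + 4 * B * (r * C) + η) * h n ^ 2 := by
  obtain ⟨R, hR, hsupp⟩ := hK.exists_eq_zero_of_lt_norm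
  have hcont : Continuous fun u =>
      1 / 2 * fderiv ℝ (fderiv ℝ f) x u u - 1 / 2 * (hessian f x).trace * μ₂ := by
    have := (fderiv ℝ (fderiv ℝ f) x).continuous.clm_apply continuous_id
    fun_prop
  refine (((hreg.withHighProb_eq_multiplierWeight hK hC hr hrC hp).and
    (hreg.withHighProb_le_sum_kernel hK)).and (hreg.withHighProb_abs_average_sub_le
      (hK.continuous.mul hcont) hK.compact_support.mul_right hη)).mono ?_
  filter_upwards [hreg.eventually_pos, hreg.tendsto_bandwidth.eventually
    (eventually_norm_taylor_two_smul_le hf hR hη)] with n hN htaylor ω hω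
  obtain ⟨⟨⟨-, l, hl, hmul, hweight⟩, hdens⟩, hlln⟩ := hω
  have hh := (hreg.bandwidth_pos n).ne'
  simp only [Pi.mul_apply, hK.integral_mul_fderiv_fderiv_sub hf, mul_zero, sub_zero] at hlln
  rw [isMultiplier_count_iff] at hmul
  rw [hweight, sum_finalWeight_multiplierWeight_mul K hh]
  refine abs_tiltedAverage_sub_le_of_taylor hK.nonneg hC hl.le hrC
    (by simpa only [tiltedKernel_smul_self] using hmul) hreg.intensity_pos hN hdens
    (h n • fderiv ℝ f x).toLinearMap (sq_nonneg _) (fun i hi => ?_) hB hquad hlln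
  have hexp := htaylor (zoom (h n) x (X i ω)) (not_lt.mp fun hlt => hi (hsupp _ hlt))
  rw [add_smul_zoom hh, Real.norm_eq_abs] at hexp
  convert hexp using 2
  simp only [ContinuousLinearMap.coe_coe, _root_.smul_apply, smul_eq_mul]
  ring

theorem IsLocallyRegular.isLittleOInProb_bias (hreg : IsLocallyRegular μ X Y x h γ)
    (hK : KernelAssumption K μ₂ ν₀ ν₂)
    (hp : ∀ n ω, (∃ q, IsAdjustmentWeights K (h n) x (fun i : Fin n => X i ω) q) →
      IsAdjustmentWeights K (h n) x (fun i : Fin n => X i ω) (p n ω))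
    {f : E w → ℝ} (hf : ContDiffAt ℝ 2 f x) :
    IsLittleOInProb μ (fun n ω =>
        ∑ i : Fin n, finalWeight K (h n) x (fun i : Fin n => X i ω) (p n ω) i * f (X i ω) -
          (f x + h n ^ 2 * (1 / 2 * (hessian f x).trace * μ₂)))
      (fun n => h n ^ 2) := by
  rw [isLittleOInProb_iff_withHighProb]
  intro ε hε
  obtain ⟨C, hC⟩ := hK.exists_norm_kernelScore_le
  have hC0 : 0 ≤ C := (norm_nonneg _).trans (hC 0)
  have hcont : Continuous fun u =>
      1 / 2 * fderiv ℝ (fderiv ℝ f) x u u - 1 / 2 * (hessian f x).trace * μ₂ := by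
    have := (fderiv ℝ (fderiv ℝ f) x).continuous.clm_apply continuous_id
    fun_prop
  obtain ⟨B, hB⟩ := hK.compact_support.exists_bound_of_continuousOn hcont.continuousOn
  have hquad : ∀ u, K u ≠ 0 →
      |1 / 2 * fderiv ℝ (fderiv ℝ f) x u u - 1 / 2 * (hessian f x).trace * μ₂| ≤ |B| :=
    fun u hu => (hB u (subset_tsupport K hu)).trans (le_abs_self B)
  obtain ⟨r, hr, hrlt⟩ := exists_pos_mul_lt
    (lt_min (by norm_num : (0 : ℝ) < 1 / 8) (half_pos hε)) (C + 4 * |B| * C)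
  obtain ⟨η, hη, hηlt⟩ := exists_pos_mul_lt (half_pos hε) (4 / γ + 1)
  have hrC : r * C ≤ 1 / 8 := by
    linarith [hrlt.trans_le (min_le_left _ _), (by positivity : 0 ≤ 4 * |B| * C * r)]
  have hrB : 4 * |B| * (r * C) ≤ ε / 2 := by
    linarith [hrlt.trans_le (min_le_right _ _), mul_nonneg hC0 hr.le]
  refine (hreg.withHighProb_abs_bias_le hK hp hf (abs_nonneg B) hquad hC hr hrC hη).mono
    (Eventually.of_forall fun n ω hle => hle.trans ?_)
  exact mul_le_mul_of_nonneg_right (by linarith) (sq_nonneg _)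

theorem KernelAssumption.measurable_tiltedKernel (hK : KernelAssumption K μ₂ ν₀ ν₂) (l : E w) :
    Measurable (tiltedKernel K l) :=
  (((continuous_const.inner hK.continuous_kernelScore).measurable.const_add 1).inv).mul
    hK.continuous.measurable

theorem IsLocallyRegular.isBigOInProb_tilted_noise {κ : Kernel (E w) ℝ} [IsMarkovKernel κ]
    {y : ℝ} (hreg : IsLocallyRegular μ X Y x h γ) (hK : KernelAssumption K μ₂ ν₀ ν₂)
    (hκ : HasCondDistrib (Y 0) (X 0) κ μ) {C r : ℝ} (hC : ∀ u, ‖kernelScore K u‖ ≤ C)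
    (hrC : r * C ≤ 1 / 8) {l : ℕ → E w} (hl : ∀ᶠ n in atTop, ‖l n‖ ≤ r) :
    IsBigOInProb μ (fun n ω => ((n : ℝ) * h n ^ w)⁻¹ * ∑ i : Fin n,
        tiltedKernel K (l n) (zoom (h n) x (X i ω)) * cdfNoise κ y (X i ω, Y i ω))
      (fun n => ((n : ℝ) * h n ^ w) ^ (-(1 / 2) : ℝ)) := by
  obtain ⟨D, hD⟩ := hK.bounded
  obtain ⟨R, hR, hsupp⟩ := hK.exists_eq_zero_of_lt_norm
  have hmeas : ∀ n, Measurable fun z => tiltedKernel K (l n) (zoom (h n) x z) := fun n =>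
    (hK.measurable_tiltedKernel (l n)).comp (continuous_zoom (h n) x).measurable
  have hbound : ∀ᶠ n in atTop, ∀ z, |tiltedKernel K (l n) (zoom (h n) x z)| ≤ 2 * D :=
    hl.mono fun n hn z => abs_tiltedKernel_le
      ((abs_of_nonneg (hK.nonneg _)).trans_le (hD _)) (hC _) hn hrC
  refine hreg.isBigOInProb_average (C := 2 * D) (f := fun n z =>
    tiltedKernel K (l n) (zoom (h n) x z.1) * cdfNoise κ y z) hR ?_ ?_
  · filter_upwards [hbound] with n hn
    refine ⟨((hmeas n).comp _root_.measurable_fst).mul (measurable_cdfNoise κ y),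
      fun z => ?_, fun z hz => ?_⟩
    · rw [abs_mul]
      exact (mul_le_of_le_one_right (abs_nonneg _) (abs_cdfNoise_le_one z)).trans (hn z.1)
    · rw [tiltedKernel_eq_zero _ (hsupp _ hz), zero_mul]
  · filter_upwards [hbound] with n hn
    exact integral_mul_cdfNoise hκ (hreg.measurable_fst 0) (hreg.measurable_snd 0) (hmeas n) hn

theorem IsLocallyRegular.isBigOInProb_tilted_score (hreg : IsLocallyRegular μ X Y x h γ)
    (hK : KernelAssumption K μ₂ ν₀ ν₂) {C r : ℝ} (hC : ∀ u, ‖kernelScore K u‖ ≤ C)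
    (hrC : r * C ≤ 1 / 8) {l : ℕ → E w} (hl : ∀ᶠ n in atTop, ‖l n‖ ≤ r)
    (hmul : ∀ᶠ n in atTop, IsMultiplier μ (fun ω => kernelScore K (zoom (h n) x (X 0 ω))) (l n)) :
    IsBigOInProb μ (fun n ω => ((n : ℝ) * h n ^ w)⁻¹ * ‖∑ i : Fin n,
        tiltedKernel K (l n) (zoom (h n) x (X i ω)) • zoom (h n) x (X i ω)‖)
      (fun n => ((n : ℝ) * h n ^ w) ^ (-(1 / 2) : ℝ)) := by
  obtain ⟨R, hR, hsupp⟩ := hK.exists_eq_zero_of_lt_norm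
  refine hreg.isBigOInProb_norm_average (C := 2 * C) (f := fun n z =>
    tiltedKernel K (l n) (zoom (h n) x z) • zoom (h n) x z) hR ?_ ?_
  · filter_upwards [hl] with n hn
    have hzoom := (continuous_zoom (h n) x).measurable
    refine ⟨((hK.measurable_tiltedKernel (l n)).comp hzoom).smul hzoom, fun z => ?_,
      fun z hz => ?_⟩
    · rw [tiltedKernel_smul_self]
      exact norm_inv_one_add_inner_smul_le (hC _) hn hrC
    · rw [tiltedKernel_eq_zero _ (hsupp _ hz), zero_smul]
  · simpa only [tiltedKernel_smul_self, IsMultiplier] using hmul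

theorem IsLocallyRegular.isBigOInProb_noise {κ : Kernel (E w) ℝ} [IsMarkovKernel κ] {y : ℝ}
    (hreg : IsLocallyRegular μ X Y x h γ) (hK : KernelAssumption K μ₂ ν₀ ν₂)
    (hκ : HasCondDistrib (Y 0) (X 0) κ μ)
    (hp : ∀ n ω, (∃ q, IsAdjustmentWeights K (h n) x (fun i : Fin n => X i ω) q) →
      IsAdjustmentWeights K (h n) x (fun i : Fin n => X i ω) (p n ω)) :
    IsBigOInProb μ (fun n ω => ∑ i : Fin n,
        finalWeight K (h n) x (fun i : Fin n => X i ω) (p n ω) i * cdfNoise κ y (X i ω, Y i ω))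
      (fun n => ((n : ℝ) * h n ^ w) ^ (-(1 / 2) : ℝ)) := by
  obtain ⟨C, hC⟩ := hK.exists_norm_kernelScore_le
  have hC0 : 0 ≤ C := (norm_nonneg _).trans (hC 0)
  have hγ := hreg.intensity_pos
  have hν := hK.sq_second_moment_pos
  obtain ⟨r, hr, hrlt⟩ := exists_pos_mul_lt (by norm_num : (0 : ℝ) < 1 / 8) C
  have hrC : r * C ≤ 1 / 8 := by linarith
  obtain ⟨l₀, hl₀⟩ := (hreg.eventually_exists_isMultiplier hK hC hr hrC).choice
  have hl₀r : ∀ᶠ n in atTop, ‖l₀ n‖ ≤ r := hl₀.mono fun n hn => hn.1.le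
  refine ((hreg.isBigOInProb_tilted_noise (y := y) hK hκ hC hrC hl₀r).abs.add
    (hreg.isBigOInProb_tilted_score hK hC hrC hl₀r (hl₀.mono fun n hn => hn.2))).of_abs_le_mul
      hreg.rate_nonneg (c := 4 / γ + 8 * C / (γ * ν₂ / 2)) (by positivity) ?_
  refine ((hreg.withHighProb_eq_multiplierWeight hK hC hr hrC hp).and
    (hreg.withHighProb_le_sum_kernel hK)).mono ?_
  filter_upwards [hreg.eventually_pos, hl₀r] with n hN hl₀n ω hω
  obtain ⟨⟨hquad, l, hl, hmul, hweight⟩, hdens⟩ := hω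
  rw [hweight, sum_finalWeight_multiplierWeight_mul K (hreg.bandwidth_pos n).ne']
  exact (abs_tiltedAverage_le_of_isMultiplier hK.nonneg hC hl.le hl₀n hrC hγ hN (by positivity)
    hmul hquad hdens fun i => abs_cdfNoise_le_one _).trans (by gcongr; exact le_abs_self _)

end Estimator

section Assumptions

theorem MixingAssumption.isBigO_inv_sq {Ω S : Type*} [MeasurableSpace Ω] [MeasurableSpace S]
    {μ : Measure Ω} {V : ℕ → Ω → S} {δ : ℝ} (hmix : MixingAssumption μ V δ) (hδ : 0 ≤ δ) :
    alphaMixing μ V =O[atTop] fun τ : ℕ => ((τ : ℝ) ^ 2)⁻¹ := by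
  refine hmix.rate.trans (Asymptotics.IsBigO.of_norm_eventuallyLE ?_)
  filter_upwards [eventually_ge_atTop 1] with τ hτ
  rw [Real.norm_of_nonneg (by positivity), ← Real.rpow_natCast, ← Real.rpow_neg (by positivity)]
  exact Real.rpow_le_rpow_of_exponent_le (mod_cast hτ) (by push_cast; linarith)

theorem BandwidthAssumption.tendsto_mul_pow {w : ℕ} {δ : ℝ} {h : ℕ → ℝ}
    (hh : BandwidthAssumption w δ h) (hδ : 0 ≤ δ) :
    Tendsto (fun n : ℕ => (n : ℝ) * h n ^ w) atTop atTop := by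
  refine tendsto_atTop_mono' _ ?_ hh.tendsto_top
  filter_upwards [hh.tendsto_zero.eventually (gt_mem_nhds zero_lt_one)] with n hn
  rw [← Real.rpow_natCast (h n) w]
  refine mul_le_mul_of_nonneg_left (Real.rpow_le_rpow_of_exponent_ge (hh.pos n) hn.le ?_)
    n.cast_nonneg
  exact le_mul_of_one_le_right w.cast_nonneg (le_add_of_nonneg_right (by positivity))

theorem estimator_eq_sum_cdfNoise_add {w n : ℕ} (κ : Kernel (E w) ℝ) (K : E w → ℝ) (h : ℝ)
    (x : E w) (xs : Fin n → E w) (ys : Fin n → ℝ) (p : Fin n → ℝ) (y : ℝ) :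
    estimator K h x xs ys p y = ∑ i, finalWeight K h x xs p i * cdfNoise κ y (xs i, ys i) +
      ∑ i, finalWeight K h x xs p i * condCDF κ y (xs i) := by
  simp only [estimator, cdfNoise, ← Finset.sum_add_distrib, ← mul_add, sub_add_cancel]

end Assumptions

end RNW

theorem mainTheorem3_general {Ω : Type*} [MeasurableSpace Ω] {μ : Measure Ω}
    [IsProbabilityMeasure μ] {w : ℕ} {X : ℕ → Ω → RNW.E w} {Y : ℕ → Ω → ℝ}
    (hX : ∀ i, Measurable (X i)) (hY : ∀ i, Measurable (Y i))
    (hstat : RNW.IsStationary μ fun i ω => (X i ω, Y i ω))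
    (hmix : RNW.alphaMixing μ (fun i ω => (X i ω, Y i ω)) =O[atTop] fun τ : ℕ => ((τ : ℝ) ^ 2)⁻¹)
    {κ : Kernel (RNW.E w) ℝ} [IsMarkovKernel κ] (hκ : HasCondDistrib (Y 0) (X 0) κ μ)
    {g : RNW.E w → ℝ} (hg : RNW.HasDensity μ (X 0) g) {G : ℕ → RNW.E w × RNW.E w → ℝ}
    (hG : ∀ i, 1 ≤ i → RNW.HasDensity μ (fun ω => (X 0 ω, X i ω)) (G i))
    {x : RNW.E w} {y : ℝ} (hF : ContDiffAt ℝ 2 (fun z => RNW.condCDF κ y z) x) (hgpos : 0 < g x)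
    (hgcont : ContinuousAt g x)
    (hGbound : ∃ M : ℝ, 0 < M ∧ ∀ i : ℕ, 1 ≤ i → ∀ u v : RNW.E w, |G i (u, v) - g u * g v| ≤ M)
    {K : RNW.E w → ℝ} {μ₂ ν₀ ν₂ : ℝ} (hK : RNW.KernelAssumption K μ₂ ν₀ ν₂)
    {h : ℕ → ℝ} (hpos : ∀ n, 0 < h n) (hzero : Tendsto h atTop (𝓝 0))
    (htop : Tendsto (fun n : ℕ => (n : ℝ) * h n ^ w) atTop atTop)
    {p : ∀ n : ℕ, Ω → Fin n → ℝ}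
    (hp : ∀ (n : ℕ) (ω : Ω),
      (∃ q, RNW.IsAdjustmentWeights K (h n) x (fun i : Fin n => X i ω) q) →
        RNW.IsAdjustmentWeights K (h n) x (fun i : Fin n => X i ω) (p n ω)) :
    ∃ R₁ R₂ : ℕ → Ω → ℝ,
      (∀ (n : ℕ) (ω : Ω),
        RNW.estimator K (h n) x (fun i : Fin n => X i ω) (fun i : Fin n => Y i ω) (p n ω) y
            - RNW.condCDF κ y x
          = 1 / 2 * h n ^ 2 * (RNW.hessian (fun z => RNW.condCDF κ y z) x).trace * μ₂
            + R₁ n ω + R₂ n ω) ∧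
      RNW.IsLittleOInProb μ R₁ (fun n => h n ^ 2) ∧
      RNW.IsBigOInProb μ R₂ (fun n => ((n : ℝ) * h n ^ w) ^ (-(1 / 2) : ℝ)) := by
  have hreg : RNW.IsLocallyRegular μ X Y x h (g x) :=
    RNW.isLocallyRegular_of_isStationary hX hY hstat hmix hg hG hgpos hgcont hGbound hpos hzero htop
  refine ⟨_, _, fun n ω => ?_, hreg.isLittleOInProb_bias hK hp hF,
    hreg.isBigOInProb_noise (y := y) hK hκ hp⟩
  rw [RNW.estimator_eq_sum_cdfNoise_add κ]
  ring

/-- Consistency of the reweighted Nadaraya-Watson estimator. The sample of size `n` is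
`(X 0, Y 0), …, (X (n-1), Y (n-1))`; `κ` is any version of the conditional distribution of the
response given the predictor, and `p n ω` is any choice of adjustment weights, arbitrary at those
outcomes where the maximization problem has no solution. -/
theorem mainTheorem3 {Ω : Type*} [MeasurableSpace Ω] (μ : Measure Ω) [IsProbabilityMeasure μ]
    (w : ℕ) (hw : 1 ≤ w) (X : ℕ → Ω → RNW.E w) (Y : ℕ → Ω → ℝ)
    (hX : ∀ i, Measurable (X i)) (hY : ∀ i, Measurable (Y i))
    (δ : ℝ) (hδ : 0 < δ) (hmix : RNW.MixingAssumption μ (fun i ω => (X i ω, Y i ω)) δ)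
    (κ : Kernel (RNW.E w) ℝ) [IsMarkovKernel κ] (hκ : HasCondDistrib (Y 0) (X 0) κ μ)
    (g : RNW.E w → ℝ) (hg : RNW.HasDensity μ (X 0) g)
    (G : ℕ → RNW.E w × RNW.E w → ℝ)
    (hG : ∀ i, 1 ≤ i → RNW.HasDensity μ (fun ω => (X 0 ω, X i ω)) (G i))
    (x : RNW.E w) (y : ℝ) (hsmooth : RNW.SmoothnessAssumption κ g G x y)
    (K : RNW.E w → ℝ) (μ₂ ν₀ ν₂ : ℝ) (hK : RNW.KernelAssumption K μ₂ ν₀ ν₂)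
    (h : ℕ → ℝ) (hh : RNW.BandwidthAssumption w δ h)
    (p : ∀ n : ℕ, Ω → Fin n → ℝ)
    (hp : ∀ (n : ℕ) (ω : Ω),
      (∃ q, RNW.IsAdjustmentWeights K (h n) x (fun i : Fin n => X i ω) q) →
        RNW.IsAdjustmentWeights K (h n) x (fun i : Fin n => X i ω) (p n ω)) :
    ∃ R₁ R₂ : ℕ → Ω → ℝ,
      (∀ (n : ℕ) (ω : Ω),
        RNW.estimator K (h n) x (fun i : Fin n => X i ω) (fun i : Fin n => Y i ω) (p n ω) y
            - RNW.condCDF κ y x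
          = 1 / 2 * h n ^ 2 * (RNW.hessian (fun z => RNW.condCDF κ y z) x).trace * μ₂
            + R₁ n ω + R₂ n ω) ∧
      RNW.IsLittleOInProb μ R₁ (fun n => h n ^ 2) ∧
      RNW.IsBigOInProb μ R₂ (fun n => ((n : ℝ) * h n ^ w) ^ (-(1 / 2) : ℝ)) :=
  mainTheorem3_general hX hY hmix.stationary (hmix.isBigO_inv_sq hδ.le) hκ hg hG
    hsmooth.cdf_smooth hsmooth.density_pos hsmooth.density_cont hsmooth.joint_bound hK hh.pos
    hh.tendsto_zero (hh.tendsto_mul_pow hδ.le) hp
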